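/- Let $D\subset\mathbb R^d$, $d\ge 1$, be a nonempty open set (for instance a bounded Lipschitz domain with $d\in\{1,2,3\}$) and $H=L^2(D)$, with Hilbert–Schmidt norm $\|\cdot\|_{\mathcal L_2(H)}$ for operators on $H$. Let $\gamma\in(1/2,1)$ and $T>0$. Then there are an orthonormal basis $(e_k)_{k\ge1}$ of $H$ and the operators $$A=\sum_{k\ge1}\lambda_k\langle e_k,\cdot\rangle e_k,\quad Q=\sum_{k\ge1}\mu_k\langle e_k,\cdot\rangle e_k,\qquad \lambda_k=k^2,\quad \mu_1=0,\quad \mu_k=\frac{1}{k^{\gamma+1/2}\log k}\ (k\ge2),$$ where $A$ has its natural domain, with the following properties. (i) $A$ is closed, densely defined, self-adjoint, positive definite and has a compact inverse; $Q$ is symmetric, positive semidefinite and of trace class; and $\|A^{\gamma/2}Q\|_{\mathcal L_2(H)}<\infty$. (ii) There is a constant $C>0$ such that the following holds. Let $W$ be a $Q$-Wiener process on a filtered probability space $(\Omega,\mathcal F,(\mathcal F_t)_{t\ge0},P)$, let $X_0\in L^4(\Omega,H)$ be $\mathcal F_0$-measurable with $E\|A^{\iota/2}X_0\|^4<\infty$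 for some $\iota\ge\gamma/2$ (for instance $X_0=0$), and let $$X_t=S(t)X_0+\int_0^tS(t-s)\,dW_s,\qquad t\ge0,$$ be the mild solution of $dX_t+AX_t\,dt=dW_t$, where $S$ is the strongly continuous semigroup generated by $-A$. Put $$RV_T^{\Delta,I}=\sum_{i=1}^{\lfloor T/\Delta\rfloor}(X_{i\Delta}-X_{(i-1)\Delta})^{\otimes2},\qquad f^{\otimes 2}=\langle f,\cdot\rangle f.$$ Then, for all sufficiently small $\Delta>0$, $RV_T^{\Delta,I}$ is integrable and $$\left(E\left\|\frac{RV_T^{\Delta,I}}{T}-Q\right\|_{\mathcal L_2(H)}^2\right)^{1/2}\ \ge\ \left\|E\left[\frac{RV_T^{\Delta,I}}{T}\right]-Q\right\|_{\mathcal L_2(H)}\ \ge\ C\,\frac{\Delta^{\gamma/2}}{|\log\Delta|}.$$ -/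

import Mathlib

open MeasureTheory ProbabilityTheory Filter Topology
open scoped ENNReal NNReal RealInnerProductSpace

namespace RealizedCovariation

noncomputable section

set_option linter.unusedSectionVars false

section Operators

variable {H : Type*} [NormedAddCommGroup H] [InnerProductSpace ℝ H] [CompleteSpace H]

/-! ### Hilbert-Schmidt norm and trace class covariances -/

/-- A fixed orthonormal basis of `H`, used to write down the Hilbert-Schmidt norm. -/
def onb (H : Type*) [NormedAddCommGroup H] [InnerProductSpace ℝ H] [CompleteSpace H] :
    HilbertBasis (exists_hilbertBasis ℝ H).choose ℝ H :=
  (exists_hilbertBasis ℝ H).choose_spec.choose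

/-- The Hilbert-Schmidt norm `(∑ ‖B bᵢ‖²)^(1/2)` as an element of `[0, ∞]`; it is finite exactly
for Hilbert-Schmidt operators. The next lemmas show that any orthonormal basis may be used. -/
def hsNorm (B : H →L[ℝ] H) : ℝ≥0∞ :=
  (∑' i, ‖B (onb H i)‖ₑ ^ 2) ^ (1 / 2 : ℝ)

/-- Parseval's identity in `[0, ∞]`. -/
lemma tsum_enorm_inner_sq {ι : Type*} (b : HilbertBasis ι ℝ H) (v : H) :
    ∑' i, ‖⟪b i, v⟫‖ₑ ^ 2 = ‖v‖ₑ ^ 2 := by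
  have h := b.hasSum_inner_mul_inner v v
  have h2 : HasSum (fun i => ⟪b i, v⟫ ^ 2) (‖v‖ ^ 2) := by
    rw [← real_inner_self_eq_norm_sq]
    have hf : (fun i => ⟪b i, v⟫ ^ 2) = fun i => ⟪v, b i⟫ * ⟪b i, v⟫ := by
      funext i
      rw [real_inner_comm v (b i), sq]
    rw [hf]
    exact h
  have h3 := ENNReal.ofReal_tsum_of_nonneg (fun i => sq_nonneg ⟪b i, v⟫) h2.summable
  rw [h2.tsum_eq, ENNReal.ofReal_pow (norm_nonneg _), ofReal_norm] at h3
  rw [h3]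
  refine tsum_congr fun i => ?_
  rw [← sq_abs, ENNReal.ofReal_pow (abs_nonneg _), ← Real.norm_eq_abs, ofReal_norm]

lemma tsum_enorm_sq_adjoint {ι κ : Type*} (b : HilbertBasis ι ℝ H) (c : HilbertBasis κ ℝ H)
    (B : H →L[ℝ] H) :
    ∑' i, ‖B (b i)‖ₑ ^ 2 = ∑' j, ‖(ContinuousLinearMap.adjoint B) (c j)‖ₑ ^ 2 := by
  simp_rw [← tsum_enorm_inner_sq c (B _), ← tsum_enorm_inner_sq b (ContinuousLinearMap.adjoint B _)]
  rw [ENNReal.tsum_comm]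
  refine tsum_congr fun j => tsum_congr fun i => ?_
  rw [ContinuousLinearMap.adjoint_inner_right, real_inner_comm]

/-- The Hilbert-Schmidt norm can be computed in any orthonormal basis. -/
lemma hsNorm_eq {ι : Type*} (b : HilbertBasis ι ℝ H) (B : H →L[ℝ] H) :
    hsNorm B = (∑' i, ‖B (b i)‖ₑ ^ 2) ^ (1 / 2 : ℝ) := by
  rw [hsNorm, tsum_enorm_sq_adjoint (onb H) b B, ← tsum_enorm_sq_adjoint b b B]

/-- A covariance operator of trace class: symmetric, positive semidefinite, with finite trace. -/
structure IsTraceClassCovariance (Q : H →L[ℝ] H) : Prop where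
  isPositive : Q.IsPositive
  summable_trace : ∀ {s : Set H} (b : HilbertBasis s ℝ H), Summable fun i => ⟪Q (b i), b i⟫

/-! ### Diagonal operators and fractional powers -/

/-- The (possibly unbounded) diagonal operator `v ↦ ∑ cⱼ ⟪eⱼ, v⟫ eⱼ` on its natural domain
`{v | ∑ (cⱼ ⟪eⱼ, v⟫)² < ∞}`. -/
def diagOp (e : HilbertBasis ℕ ℝ H) (c : ℕ → ℝ) : H →ₗ.[ℝ] H where
  domain :=
    { carrier := {v | Memℓp (fun j => c j * ⟪e j, v⟫) 2}
      zero_mem' := by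
        have h : (fun j => c j * ⟪e j, (0 : H)⟫) = 0 := by ext j; simp
        change Memℓp _ 2
        rw [h]
        exact zero_memℓp
      add_mem' := by
        intro v w hv hw
        change Memℓp _ 2
        convert Memℓp.add hv hw using 1
        ext j
        simp [inner_add_right, mul_add]
      smul_mem' := by
        intro a v hv
        change Memℓp _ 2
        convert Memℓp.const_smul hv a using 1
        ext j
        simp [inner_smul_right, mul_left_comm] }
  toFun :=
    { toFun := fun v => e.repr.symm ⟨fun j => c j * ⟪e j, (v : H)⟫, v.2⟩
      map_add' := by
        intro v w
        rw [← map_add]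
        congr 1
        ext j
        change _ = c j * ⟪e j, (v : H)⟫ + c j * ⟪e j, (w : H)⟫
        simp [inner_add_right, mul_add]
      map_smul' := by
        intro a v
        rw [RingHom.id_apply, ← map_smul]
        congr 1
        ext j
        change _ = a * (c j * ⟪e j, (v : H)⟫)
        simp [inner_smul_right, mul_left_comm] }

lemma mem_graph_diagOp (e : HilbertBasis ℕ ℝ H) (c : ℕ → ℝ) (v w : H) :
    (v, w) ∈ (diagOp e c).graph ↔ ∀ j, ⟪e j, w⟫ = c j * ⟪e j, v⟫ := by
  rw [LinearPMap.mem_graph_iff]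
  constructor
  · rintro ⟨y, hy, hw⟩ j
    simp only at hy hw
    rw [← hw, ← e.repr_apply_apply, ← hy]
    change (e.repr (e.repr.symm _)) j = _
    rw [LinearIsometryEquiv.apply_symm_apply]
  · intro h
    have hfun : (fun j => c j * ⟪e j, v⟫) = (e.repr w : ℕ → ℝ) := by
      ext j
      rw [e.repr_apply_apply, h]
    have hmem : Memℓp (fun j => c j * ⟪e j, v⟫) 2 := by
      rw [hfun]
      exact lp.memℓp _
    refine ⟨⟨v, hmem⟩, rfl, ?_⟩
    change e.repr.symm _ = w
    rw [LinearIsometryEquiv.symm_apply_eq]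
    ext j
    exact congrFun hfun j

open Classical in
/-- The fractional power `A ^ r` of a positive definite self-adjoint operator `A` with compact
inverse: if `A = ∑ λⱼ ⟪eⱼ, ·⟫ eⱼ` with an orthonormal basis `(eⱼ)` and `λⱼ > 0`, then
`A ^ r = ∑ λⱼ ^ r ⟪eⱼ, ·⟫ eⱼ` on its natural domain. The next lemma shows that the result does not
depend on the choice of the eigenbasis. (If there is no such eigenbasis, the value is junk.) -/
def fracPow (A : H →ₗ.[ℝ] H) (r : ℝ) : H →ₗ.[ℝ] H :=
  if h : ∃ p : HilbertBasis ℕ ℝ H × (ℕ → ℝ), (∀ j, 0 < p.2 j) ∧ A = diagOp p.1 p.2 then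
    diagOp h.choose.1 (fun j => h.choose.2 j ^ r)
  else ⊥

lemma diagOp_rpow_le {e f : HilbertBasis ℕ ℝ H} {l m : ℕ → ℝ} (h : diagOp e l = diagOp f m)
    (r : ℝ) {v w : H} (hvw : (v, w) ∈ (diagOp e fun j => l j ^ r).graph) :
    (v, w) ∈ (diagOp f fun j => m j ^ r).graph := by
  rw [mem_graph_diagOp] at hvw ⊢
  have horth : ∀ i k, ⟪f k, e i⟫ * l i ^ r = ⟪f k, e i⟫ * m k ^ r := by
    intro i k
    have h1 : (e i, l i • e i) ∈ (diagOp e l).graph := by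
      rw [mem_graph_diagOp]
      intro j
      rw [inner_smul_right]
      by_cases hji : j = i
      · rw [hji]
      · simp [e.orthonormal.2 hji]
    rw [h, mem_graph_diagOp] at h1
    have h2 := h1 k
    rw [inner_smul_right] at h2
    by_cases h0 : ⟪f k, e i⟫ = 0
    · simp [h0]
    · rw [mul_right_cancel₀ h0 h2]
  intro k
  rw [← e.tsum_inner_mul_inner (f k) w, ← e.tsum_inner_mul_inner (f k) v, ← tsum_mul_left]
  refine tsum_congr fun i => ?_
  rw [hvw i, ← mul_assoc, horth i k]
  ring

lemma fracPow_diagOp (e : HilbertBasis ℕ ℝ H) (l : ℕ → ℝ) (hl : ∀ j, 0 < l j) (r : ℝ) :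
    fracPow (diagOp e l) r = diagOp e (fun j => l j ^ r) := by
  have h : ∃ p : HilbertBasis ℕ ℝ H × (ℕ → ℝ),
      (∀ j, 0 < p.2 j) ∧ diagOp e l = diagOp p.1 p.2 := ⟨(e, l), hl, rfl⟩
  rw [fracPow, dif_pos h]
  apply LinearPMap.eq_of_eq_graph
  ext ⟨v, w⟩
  exact ⟨diagOp_rpow_le h.choose_spec.2.symm r, diagOp_rpow_le h.choose_spec.2 r⟩

open Classical in
/-- `‖A ^ r v‖`, with the value `∞` if `v` is not in the domain of `A ^ r`. -/
def normPow (A : H →ₗ.[ℝ] H) (r : ℝ) (v : H) : ℝ≥0∞ :=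
  if h : v ∈ (fracPow A r).domain then ‖fracPow A r ⟨v, h⟩‖ₑ else ∞

/-! ### The assumptions on the operators -/

/-- `A` is closed, densely defined, self-adjoint, positive definite and has a compact inverse. -/
structure IsEllipticOperator (A : H →ₗ.[ℝ] H) : Prop where
  isClosed : A.IsClosed
  dense : Dense (A.domain : Set H)
  isSelfAdjoint : IsSelfAdjoint A
  posDef : ∀ v : A.domain, (v : H) ≠ 0 → 0 < ⟪A v, (v : H)⟫
  compact_inverse : ∃ K : H →L[ℝ] H, IsCompactOperator K ∧
    (∀ w : H, ∃ h : K w ∈ A.domain, A ⟨K w, h⟩ = w) ∧ ∀ v : A.domain, K (A v) = v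

/-- The assumptions on the pair `(A, Q)` with regularity index `γ`: `A` is as above, `Q` is a
trace class covariance, and `A ^ (γ / 2) Q` is an (everywhere defined) Hilbert-Schmidt operator. -/
structure OperatorAssumption (A : H →ₗ.[ℝ] H) (Q : H →L[ℝ] H) (γ : ℝ) : Prop where
  isEllipticOperator : IsEllipticOperator A
  isTraceClassCovariance : IsTraceClassCovariance Q
  hilbertSchmidt : ∃ B : H →L[ℝ] H,
    (∀ v, ∃ h : Q v ∈ (fracPow A (γ / 2)).domain, fracPow A (γ / 2) ⟨Q v, h⟩ = B v) ∧ hsNorm B < ∞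

/-- `S` is the strongly continuous semigroup with generator `-A`. -/
structure IsSemigroupGeneratedByNeg (S : ℝ → H →L[ℝ] H) (A : H →ₗ.[ℝ] H) : Prop where
  zero : S 0 = ContinuousLinearMap.id ℝ H
  add : ∀ s t : ℝ, 0 ≤ s → 0 ≤ t → S (s + t) = S s ∘L S t
  continuousOn : ∀ v, ContinuousOn (fun t => S t v) (Set.Ici 0)
  generator : ∀ v w : H, Tendsto (fun t : ℝ => t⁻¹ • (S t v - v)) (𝓝[>] 0) (𝓝 w) ↔
    ∃ h : v ∈ A.domain, -A ⟨v, h⟩ = w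

end Operators

section Processes

variable {H : Type*} [NormedAddCommGroup H] [InnerProductSpace ℝ H] [CompleteSpace H]
variable {Ω : Type*} {mΩ : MeasurableSpace Ω}

/-! ### Wiener processes, Wiener integrals and mild solutions -/

/-- `W` is a `Q`-Wiener process with respect to the filtration `ℱ`. -/
structure IsQWiener (W : ℝ≥0 → Ω → H) (Q : H →L[ℝ] H) (ℱ : Filtration ℝ≥0 mΩ)
    (P : Measure Ω) : Prop where
  zero : ∀ᵐ ω ∂P, W 0 ω = 0
  continuous : ∀ᵐ ω ∂P, Continuous fun t => W t ω
  adapted : StronglyAdapted ℱ W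
  indep : ∀ s t, s ≤ t →
    Indep (MeasurableSpace.comap (fun ω => W t ω - W s ω) (borel H)) (ℱ s) P
  gaussian : ∀ s t, s ≤ t → ∀ u : H,
    P.map (fun ω => ⟪W t ω - W s ω, u⟫) =
      gaussianReal 0 (Real.toNNReal (((t : ℝ) - s) * ⟪Q u, u⟫))

/-- An elementary deterministic integrand `∑ᵢ 1_{(aᵢ, bᵢ]} Bᵢ`. -/
structure ElementaryIntegrand (H : Type*) [NormedAddCommGroup H] [InnerProductSpace ℝ H] where
  n : ℕ
  left : Fin n → ℝ≥0
  right : Fin n → ℝ≥0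
  left_le_right : ∀ i, left i ≤ right i
  coeff : Fin n → H →L[ℝ] H

open Classical in
/-- The operator-valued step function of an elementary integrand. -/
def ElementaryIntegrand.eval (Φ : ElementaryIntegrand H) (s : ℝ) : H →L[ℝ] H :=
  ∑ i, if s ∈ Set.Ioc (Φ.left i : ℝ) (Φ.right i) then Φ.coeff i else 0

/-- The integral `∑ᵢ Bᵢ (W_{bᵢ} - W_{aᵢ})` of an elementary integrand. -/
def ElementaryIntegrand.integral (Φ : ElementaryIntegrand H) (W : ℝ≥0 → Ω → H) (ω : Ω) : H :=
  ∑ i, Φ.coeff i (W (Φ.right i) ω - W (Φ.left i) ω)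

/-- `Y` is the stochastic integral `∫₀ᵗ Ψ(s) dW_s` of the deterministic integrand `Ψ`: it is the
limit in `L²(Ω, H)` of integrals of elementary integrands `Φₙ` on `[0, t]` with
`∫₀ᵗ ‖(Φₙ(s) - Ψ(s)) Q^{1/2}‖² ds → 0` in Hilbert-Schmidt norm. By the Itô isometry, `Y` does not
depend on the sequence, up to null sets. -/
def IsWienerIntegral (W : ℝ≥0 → Ω → H) (Q : H →L[ℝ] H) (P : Measure Ω) (t : ℝ≥0)
    (Ψ : ℝ → H →L[ℝ] H) (Y : Ω → H) : Prop :=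
  MemLp Y 2 P ∧
  ∃ R : H →L[ℝ] H, R.IsPositive ∧ R ∘L R = Q ∧
  ∃ Φ : ℕ → ElementaryIntegrand H, (∀ n i, (Φ n).right i ≤ t) ∧
    Tendsto (fun n => ∫⁻ s in Set.Ioc (0 : ℝ) t, hsNorm (((Φ n).eval s - Ψ s) ∘L R) ^ 2)
      atTop (𝓝 0) ∧
    Tendsto (fun n => eLpNorm (fun ω => (Φ n).integral W ω - Y ω) 2 P) atTop (𝓝 0)

/-- `X` is the mild solution `X_t = S(t) X₀ + ∫₀ᵗ S(t - s) dW_s` of `dX + A X dt = dW`, where `S` is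
the semigroup generated by `-A`. -/
def IsMildSolution (A : H →ₗ.[ℝ] H) (Q : H →L[ℝ] H) (W : ℝ≥0 → Ω → H) (X₀ : Ω → H)
    (X : ℝ≥0 → Ω → H) (P : Measure Ω) : Prop :=
  ∃ S : ℝ → H →L[ℝ] H, IsSemigroupGeneratedByNeg S A ∧
    ∀ t : ℝ≥0, ∃ Y : Ω → H, IsWienerIntegral W Q P t (fun s => S (t - s)) Y ∧
      ∀ᵐ ω ∂P, X t ω = S t (X₀ ω) + Y ω

/-- The assumptions on the initial value with regularity index `ι`: it is `ℱ₀`-measurable, lies in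
`L⁴(Ω, H)`, and `‖A ^ (ι / 2) X₀‖_{L⁴(Ω, H)} < ∞`. -/
structure InitialAssumption (A : H →ₗ.[ℝ] H) (X₀ : Ω → H) (ι : ℝ) (ℱ : Filtration ℝ≥0 mΩ)
    (P : Measure Ω) : Prop where
  stronglyMeasurable : StronglyMeasurable[ℱ 0] X₀
  memLp : MemLp X₀ 4 P
  regularity : ∫⁻ ω, normPow A (ι / 2) (X₀ ω) ^ 4 ∂P < ∞

/-- The realized covariation `∑_{i=1}^{⌊T/Δ⌋} (X_{iΔ} - X_{(i-1)Δ})^{⊗2}` from perfect spatial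
observations. -/
def realizedCovariation (X : ℝ≥0 → Ω → H) (T Δ : ℝ≥0) (ω : Ω) : H →L[ℝ] H :=
  ∑ i ∈ Finset.range ⌊T / Δ⌋₊,
    InnerProductSpace.rankOne ℝ (X ((i + 1) * Δ) ω - X (i * Δ) ω) (X ((i + 1) * Δ) ω - X (i * Δ) ω)

/-- The norm of `L²(Ω, L₂(H))`. -/
def hsL2Norm (Z : Ω → H →L[ℝ] H) (P : Measure Ω) : ℝ≥0∞ :=
  (∫⁻ ω, hsNorm (Z ω) ^ 2 ∂P) ^ (1 / 2 : ℝ)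

end Processes

/-- The eigenvalues `μ_k = 1 / (k^{γ + 1/2} log k)`, `k ≥ 2`, and `μ₁ = 0`, indexed by
`k = j + 1`. -/
def noiseEigenvalue (γ : ℝ) (j : ℕ) : ℝ :=
  if j = 0 then 0 else 1 / ((j + 1 : ℝ) ^ (γ + 1 / 2) * Real.log (j + 1))

end

end RealizedCovariation

open RealizedCovariation

set_option linter.unusedSectionVars false

namespace RealizedCovariation

/-! ### Diagonal operators: compactness, self-adjointness, trace -/

section Diagonal

variable {H : Type*} [NormedAddCommGroup H] [InnerProductSpace ℝ H] [CompleteSpace H]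

/-! Since `A` and `Q` are diagonal in one basis, the problem splits into modes. Write `λ = l k`, `μ
= ⟪Q e_k, e_k⟫` and `m_k = E⟪e_k, X₀⟫²`. The `k`-th coordinate of `X` is an Ornstein–Uhlenbeck
process, and the noise part of its increment over a step `Δ` has second moment at most `μ (1 - exp
(-λΔ)) / λ ≤ μ / λ`, however long the step is. There are at most `T / Δ` steps, so the `k`-th
diagonal entry of `E[RV] / T` is at most `m_k / T + μ / (λΔ)`
(`inner_integral_realizedCovariation_le`). Once `λΔ ≥ 2`, realized covariation therefore misses at
least half of `μ`, up to the initial-value term.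

These deficits are collected over a window of `K` modes starting at `K ≈ Δ ^ (-1/2)`. By
Cauchy–Schwarz the Hilbert–Schmidt norm of the bias is at least the sum of the deficits divided by
`√K` (`ofReal_sum_inner_div_sqrt_card_le_hsNorm`). The eigenvalues contribute about `K · K ^ (-γ -
1/2) / (log K · √K) = K ^ (-γ) / log K`, which is of order `Δ ^ (γ/2) / |log Δ|`. The regularity of
`X₀` bounds the sum of `m_k` over the window by a multiple of `K ^ (-γ)`
(`InitialAssumption.exists_sum_weighted_le`); after division by `√K` this is of lower order.

The second moments of the coordinates come from the Itô isometry for step integrands, passed to the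
limit in `eLpNorm_add_inner_sub_inner_sq_le`. That the mean-square error dominates the bias is
Jensen's inequality. The logarithm in `μ` makes `∑ (λ ^ (γ/2) μ)² = ∑ 1 / (k log² k)` just converge,
so `A ^ (γ/2) Q` is still Hilbert–Schmidt. -/

lemma ext_inner_basis {ι : Type*} (e : HilbertBasis ι ℝ H) {v w : H}
    (h : ∀ j, ⟪e j, v⟫ = ⟪e j, w⟫) : v = w := by
  apply e.repr.injective
  ext j
  rw [e.repr_apply_apply, e.repr_apply_apply, h]

lemma inner_basis_basis {ι : Type*} [DecidableEq ι] (e : HilbertBasis ι ℝ H) (i j : ι) :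
    ⟪e i, e j⟫ = if i = j then 1 else 0 :=
  orthonormal_iff_ite.mp e.orthonormal i j

lemma exists_diagonal_clm (e : HilbertBasis ℕ ℝ H) {c : ℕ → ℝ} {M : ℝ} (hM : 0 ≤ M)
    (hc : ∀ j, |c j| ≤ M) :
    ∃ B : H →L[ℝ] H, ‖B‖ ≤ M ∧ ∀ v j, ⟪e j, B v⟫ = c j * ⟪e j, v⟫ := by
  have hle : ∀ (v : H) j, ‖c j * ⟪e j, v⟫‖ ≤ ‖(M • e.repr v : lp (fun _ : ℕ => ℝ) 2) j‖ := by
    intro v j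
    rw [lp.coeFn_smul, Pi.smul_apply, e.repr_apply_apply, norm_mul, smul_eq_mul, norm_mul,
      Real.norm_eq_abs, Real.norm_of_nonneg hM]
    gcongr
    exact hc j
  have hmem : ∀ v : H, Memℓp (fun j => c j * ⟪e j, v⟫) 2 := by
    intro v
    have h1 := (memℓp_gen_iff (p := 2) (by norm_num)).1
      (lp.memℓp (M • e.repr v : lp (fun _ : ℕ => ℝ) 2))
    refine memℓp_gen (h1.of_nonneg_of_le (fun j => by positivity) fun j => ?_)
    exact Real.rpow_le_rpow (norm_nonneg _) (hle v j) (by norm_num)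
  let L : H →ₗ[ℝ] H :=
    { toFun := fun v => e.repr.symm ⟨fun j => c j * ⟪e j, v⟫, hmem v⟩
      map_add' := by
        intro v w
        rw [← map_add]
        congr 1
        ext j
        change _ = c j * ⟪e j, v⟫ + c j * ⟪e j, w⟫
        simp [inner_add_right, mul_add]
      map_smul' := by
        intro a v
        rw [RingHom.id_apply, ← map_smul]
        congr 1
        ext j
        change _ = a * (c j * ⟪e j, v⟫)
        simp [inner_smul_right, mul_left_comm] }
  have hL : ∀ v, ‖L v‖ ≤ M * ‖v‖ := by
    intro v
    change ‖e.repr.symm _‖ ≤ _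
    rw [LinearIsometryEquiv.norm_map, ← e.repr.norm_map v]
    refine le_of_le_of_eq ?_ ((norm_smul M (e.repr v)).trans (by rw [Real.norm_of_nonneg hM]))
    exact lp.norm_mono (by norm_num) fun j => hle v j
  refine ⟨L.mkContinuous M hL, L.mkContinuous_norm_le hM hL, fun v j => ?_⟩
  rw [← e.repr_apply_apply]
  change (e.repr (e.repr.symm _)) j = _
  rw [LinearIsometryEquiv.apply_symm_apply]

lemma exists_diagonal_clm_of_summable (e : HilbertBasis ℕ ℝ H) {c : ℕ → ℝ} (hc : Summable c) :
    ∃ B : H →L[ℝ] H, ∀ v j, ⟪e j, B v⟫ = c j * ⟪e j, v⟫ := by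
  obtain ⟨M, hM⟩ := hc.tendsto_atTop_zero.abs.bddAbove_range
  have hM' : ∀ j, |c j| ≤ M := fun j => hM ⟨j, rfl⟩
  obtain ⟨B, -, hB⟩ := exists_diagonal_clm e ((abs_nonneg _).trans (hM' 0)) hM'
  exact ⟨B, hB⟩

lemma diagonal_apply_basis {e : HilbertBasis ℕ ℝ H} {c : ℕ → ℝ} {B : H →L[ℝ] H}
    (hB : ∀ v j, ⟪e j, B v⟫ = c j * ⟪e j, v⟫) (j : ℕ) : B (e j) = c j • e j := by
  refine ext_inner_basis e fun i => ?_
  rw [hB, inner_smul_right, inner_basis_basis]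
  split_ifs with h
  · rw [h]
  · simp

lemma diagonal_symm {e : HilbertBasis ℕ ℝ H} {c : ℕ → ℝ} {B : H →L[ℝ] H}
    (hB : ∀ v j, ⟪e j, B v⟫ = c j * ⟪e j, v⟫) (v w : H) : ⟪B v, w⟫ = ⟪v, B w⟫ := by
  rw [← e.tsum_inner_mul_inner (B v) w, ← e.tsum_inner_mul_inner v (B w)]
  refine tsum_congr fun j => ?_
  rw [hB, real_inner_comm, hB, real_inner_comm]
  ring

/-- `B` is the norm limit of its finite-rank truncations: the remainder is again diagonal, with norm
at most the supremum of the tail of `c`. -/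
lemma diagonal_isCompactOperator {e : HilbertBasis ℕ ℝ H} {c : ℕ → ℝ} {B : H →L[ℝ] H}
    (hB : ∀ v j, ⟪e j, B v⟫ = c j * ⟪e j, v⟫) (hc : Tendsto c atTop (𝓝 0)) :
    IsCompactOperator B := by
  let F : ℕ → H →L[ℝ] H := fun n => ∑ i ∈ Finset.range n, c i • InnerProductSpace.rankOne ℝ (e i) (e i)
  have hFc : ∀ n, IsCompactOperator (F n) := by
    intro n
    change F n ∈ compactOperator (RingHom.id ℝ) H H
    refine Submodule.sum_mem _ fun i _ => Submodule.smul_mem _ _ ?_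
    rw [InnerProductSpace.rankOne_def']
    exact (isCompactOperator_of_locallyCompactSpace_dom (innerSL ℝ (e i))).clm_comp
      (ContinuousLinearMap.toSpanSingleton ℝ (e i))
  have hF : ∀ n v j, ⟪e j, F n v⟫ = if j < n then c j * ⟪e j, v⟫ else 0 := by
    intro n v j
    simp only [F, _root_.sum_apply, inner_sum, _root_.smul_apply,
      InnerProductSpace.rankOne_apply, inner_smul_right, inner_basis_basis]
    simp
  refine isCompactOperator_of_tendsto (F := F) (l := atTop) ?_ (Eventually.of_forall hFc)
  rw [Metric.tendsto_atTop]
  intro ε hε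
  obtain ⟨N, hN⟩ := Metric.tendsto_atTop.1 hc (ε / 2) (by positivity)
  refine ⟨N, fun n hn => ?_⟩
  obtain ⟨G, hG, hG2⟩ := exists_diagonal_clm e (c := fun j => if j < n then 0 else -c j)
    (M := ε / 2) (by positivity) (by
      intro j
      split_ifs with h
      · simp; positivity
      · have := hN j (by omega)
        rw [Real.dist_eq, sub_zero] at this
        rw [abs_neg]
        exact this.le)
  have : F n - B = G := by
    ext v
    refine ext_inner_basis e fun j => ?_
    rw [_root_.sub_apply, inner_sub_right, hF, hB, hG2]
    split_ifs <;> ring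
  rw [dist_eq_norm, this]
  linarith

lemma basis_mem_graph_diagOp (e : HilbertBasis ℕ ℝ H) (c : ℕ → ℝ) (i : ℕ) :
    (e i, c i • e i) ∈ (diagOp e c).graph := by
  rw [mem_graph_diagOp]
  intro j
  rw [inner_smul_right, inner_basis_basis]
  split_ifs with h
  · rw [h]
  · simp

lemma diagOp_dense (e : HilbertBasis ℕ ℝ H) (c : ℕ → ℝ) :
    Dense ((diagOp e c).domain : Set H) := by
  have h : Submodule.span ℝ (Set.range e) ≤ (diagOp e c).domain := by
    rw [Submodule.span_le]
    rintro _ ⟨i, rfl⟩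
    exact LinearPMap.mem_domain_of_mem_graph (basis_mem_graph_diagOp e c i)
  have h2 : Dense (Submodule.span ℝ (Set.range e) : Set H) := by
    rw [Submodule.dense_iff_topologicalClosure_eq_top]
    exact e.dense_span
  exact h2.mono h

lemma inner_diagOp (e : HilbertBasis ℕ ℝ H) (c : ℕ → ℝ) (v : (diagOp e c).domain) (j : ℕ) :
    ⟪e j, diagOp e c v⟫ = c j * ⟪e j, (v : H)⟫ :=
  (mem_graph_diagOp e c v _).1 (LinearPMap.mem_graph _ v) j

/-- Testing the adjoint relation on the graph elements `(e j, c j • e j)` forces the diagonal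
relation on coordinates; the converse is Parseval, term by term. -/
lemma diagOp_isSelfAdjoint (e : HilbertBasis ℕ ℝ H) (c : ℕ → ℝ) :
    IsSelfAdjoint (diagOp e c) := by
  rw [LinearPMap.isSelfAdjoint_def]
  apply LinearPMap.eq_of_eq_graph
  rw [LinearPMap.adjoint_graph_eq_graph_adjoint (diagOp_dense e c)]
  ext ⟨v, w⟩
  rw [Submodule.mem_adjoint_iff]
  constructor
  · intro h
    rw [mem_graph_diagOp]
    intro j
    have := h _ _ (basis_mem_graph_diagOp e c j)
    rw [real_inner_smul_left] at this
    simp only at this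
    linarith
  · intro h a b hab
    rw [mem_graph_diagOp] at h hab
    simp only
    rw [sub_eq_zero, ← e.tsum_inner_mul_inner b v, ← e.tsum_inner_mul_inner a w]
    refine tsum_congr fun j => ?_
    rw [real_inner_comm, hab, h, real_inner_comm a]
    ring

lemma exists_apply_eq_of_mem_graph {A : H →ₗ.[ℝ] H} {v w : H} (h : (v, w) ∈ A.graph) :
    ∃ hv : v ∈ A.domain, A ⟨v, hv⟩ = w := by
  obtain ⟨y, rfl, hy⟩ := (LinearPMap.mem_graph_iff _).1 h
  exact ⟨y.2, hy⟩

lemma diagOp_isEllipticOperator (e : HilbertBasis ℕ ℝ H) {c : ℕ → ℝ} (hc : ∀ j, 0 < c j)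
    (hlim : Tendsto c atTop atTop) : IsEllipticOperator (diagOp e c) where
  isClosed := (diagOp_isSelfAdjoint e c).isClosed
  dense := diagOp_dense e c
  isSelfAdjoint := diagOp_isSelfAdjoint e c
  posDef := by
    intro v hv
    have hs := e.hasSum_inner_mul_inner (diagOp e c v) v
    have hterm : ∀ j, ⟪diagOp e c v, e j⟫ * ⟪e j, (v : H)⟫ = c j * ⟪e j, (v : H)⟫ ^ 2 := by
      intro j
      rw [real_inner_comm, inner_diagOp]
      ring
    obtain ⟨j, hj⟩ : ∃ j, ⟪e j, (v : H)⟫ ≠ 0 := by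
      by_contra! h
      exact hv (ext_inner_basis e fun j => by rw [h, inner_zero_right])
    rw [← hs.tsum_eq]
    refine hs.summable.tsum_pos (fun j => ?_) j ?_
    · rw [hterm]
      have := hc j
      positivity
    · rw [hterm]
      have := hc j
      positivity
  compact_inverse := by
    have hinv : Tendsto (fun j => (c j)⁻¹) atTop (𝓝 0) := tendsto_inv_atTop_zero.comp hlim
    obtain ⟨M, hM⟩ := hinv.abs.bddAbove_range
    have hM' : ∀ j, |(c j)⁻¹| ≤ M := fun j => hM ⟨j, rfl⟩
    obtain ⟨K, -, hK⟩ := exists_diagonal_clm e ((abs_nonneg _).trans (hM' 0)) hM'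
    refine ⟨K, diagonal_isCompactOperator hK hinv, fun w => ?_, fun v => ?_⟩
    · have hg : (K w, w) ∈ (diagOp e c).graph := by
        rw [mem_graph_diagOp]
        intro j
        rw [hK, mul_inv_cancel_left₀ (hc j).ne']
      exact exists_apply_eq_of_mem_graph hg
    · refine ext_inner_basis e fun j => ?_
      rw [hK, inner_diagOp, inv_mul_cancel_left₀ (hc j).ne']

/-- With `R` diagonal with entries `√(c j)`, the terms of the trace are `‖R (b i)‖²`. Their sum does
not depend on the basis, and in `e` it is `∑ c j`. -/
lemma diagonal_isTraceClassCovariance {e : HilbertBasis ℕ ℝ H} {c : ℕ → ℝ} {Q : H →L[ℝ] H}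
    (hQ : ∀ v j, ⟪e j, Q v⟫ = c j * ⟪e j, v⟫) (hc : ∀ j, 0 ≤ c j) (hs : Summable c) :
    IsTraceClassCovariance Q := by
  obtain ⟨M, hM⟩ := hs.tendsto_atTop_zero.bddAbove_range
  have hM' : ∀ j, c j ≤ M := fun j => hM ⟨j, rfl⟩
  obtain ⟨R, -, hR⟩ := exists_diagonal_clm e (c := fun j => √(c j)) (M := √M) (Real.sqrt_nonneg _)
    (fun j => by rw [abs_of_nonneg (Real.sqrt_nonneg _)]; exact Real.sqrt_le_sqrt (hM' j))
  have hRR : ∀ v, Q v = R (R v) := by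
    intro v
    refine ext_inner_basis e fun j => ?_
    rw [hQ, hR, hR, ← mul_assoc, Real.mul_self_sqrt (hc j)]
  have hin : ∀ v w, ⟪Q v, w⟫ = ⟪R v, R w⟫ := fun v w => by rw [hRR, diagonal_symm hR]
  constructor
  · rw [ContinuousLinearMap.isPositive_def]
    refine ⟨fun v w => diagonal_symm hQ v w, fun v => ?_⟩
    rw [ContinuousLinearMap.reApplyInnerSelf_apply, hin]
    exact real_inner_self_nonneg
  · intro s b
    have h1 : ∑' i, ‖R (b i)‖ₑ ^ 2 = ∑' j, ENNReal.ofReal (c j) := by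
      rw [tsum_enorm_sq_adjoint b e]
      have hadj : ContinuousLinearMap.adjoint R = R :=
        ((ContinuousLinearMap.eq_adjoint_iff R R).2 fun x y => diagonal_symm hR x y).symm
      refine tsum_congr fun j => ?_
      rw [hadj, diagonal_apply_basis hR, enorm_smul, ← ofReal_norm (e j), e.orthonormal.1 j,
        ENNReal.ofReal_one, mul_one, Real.enorm_eq_ofReal (Real.sqrt_nonneg _),
        ← ENNReal.ofReal_pow (Real.sqrt_nonneg _), Real.sq_sqrt (hc j)]
    have h2 : ∑' i, ENNReal.ofReal ⟪Q (b i), b i⟫ ≠ ∞ := by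
      have : ∀ i, ENNReal.ofReal ⟪Q (b i), b i⟫ = ‖R (b i)‖ₑ ^ 2 := by
        intro i
        rw [hin, real_inner_self_eq_norm_sq, ENNReal.ofReal_pow (norm_nonneg _), ofReal_norm]
      simp_rw [this]
      rw [h1, ← ENNReal.ofReal_tsum_of_nonneg hc hs]
      exact ENNReal.ofReal_ne_top
    have h3 := ENNReal.summable_toReal h2
    refine h3.congr fun i => ?_
    rw [ENNReal.toReal_ofReal]
    rw [hin]
    exact real_inner_self_nonneg

lemma diagonal_operatorAssumption {e : HilbertBasis ℕ ℝ H} {l c : ℕ → ℝ} {Q : H →L[ℝ] H} {γ : ℝ}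
    (hQ : ∀ v j, ⟪e j, Q v⟫ = c j * ⟪e j, v⟫) (hl : ∀ j, 0 < l j) (hlim : Tendsto l atTop atTop)
    (hc : ∀ j, 0 ≤ c j) (hs : Summable c) (hs2 : Summable fun j => (l j ^ (γ / 2) * c j) ^ 2) :
    OperatorAssumption (diagOp e l) Q γ where
  isEllipticOperator := diagOp_isEllipticOperator e hl hlim
  isTraceClassCovariance := diagonal_isTraceClassCovariance hQ hc hs
  hilbertSchmidt := by
    have hcoef : ∀ j, 0 ≤ l j ^ (γ / 2) * c j := fun j =>
      mul_nonneg (Real.rpow_nonneg (hl j).le _) (hc j)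
    obtain ⟨M, hM⟩ := hs2.tendsto_atTop_zero.bddAbove_range
    have hM' : ∀ j, |l j ^ (γ / 2) * c j| ≤ √M := fun j =>
      Real.abs_le_sqrt (hM ⟨j, rfl⟩)
    obtain ⟨B, -, hB⟩ := exists_diagonal_clm e (Real.sqrt_nonneg M) hM'
    rw [fracPow_diagOp e l hl]
    refine ⟨B, fun v => ?_, ?_⟩
    · have hg : (Q v, B v) ∈ (diagOp e fun j => l j ^ (γ / 2)).graph := by
        rw [mem_graph_diagOp]
        intro j
        rw [hB, hQ, mul_assoc]
      exact exists_apply_eq_of_mem_graph hg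
    · rw [hsNorm_eq e]
      refine ENNReal.rpow_lt_top_of_nonneg (by norm_num) ?_
      have : ∀ j, ‖B (e j)‖ₑ ^ 2 = ENNReal.ofReal ((l j ^ (γ / 2) * c j) ^ 2) := by
        intro j
        rw [diagonal_apply_basis hB, enorm_smul, ← ofReal_norm (e j), e.orthonormal.1 j,
          ENNReal.ofReal_one, mul_one, Real.enorm_eq_ofReal (hcoef j),
          ENNReal.ofReal_pow (hcoef j)]
      simp_rw [this]
      rw [← ENNReal.ofReal_tsum_of_nonneg (fun j => sq_nonneg _) hs2]
      exact ENNReal.ofReal_ne_top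

end Diagonal

/-! ### Summability of the noise eigenvalues -/

section Eigenvalues

lemma noiseEigenvalue_nonneg (γ : ℝ) (j : ℕ) : 0 ≤ noiseEigenvalue γ j := by
  rw [noiseEigenvalue]
  split_ifs with h
  · rfl
  · have : 0 ≤ Real.log ((j : ℝ) + 1) := Real.log_nonneg (by simp)
    positivity

lemma noiseEigenvalue_summable {γ : ℝ} (hγ : 1 / 2 < γ) : Summable (noiseEigenvalue γ) := by
  have h1 : Summable fun n : ℕ => 1 / (n : ℝ) ^ (γ + 1 / 2) :=
    Real.summable_one_div_nat_rpow.2 (by linarith)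
  have h2 := (summable_nat_add_iff 1).2 h1
  refine (h2.mul_left (1 / Real.log 2)).of_nonneg_of_le (noiseEigenvalue_nonneg γ) fun j => ?_
  have hlog2 : 0 < Real.log 2 := Real.log_pos (by norm_num)
  rw [noiseEigenvalue]
  split_ifs with h
  · positivity
  · have hj : (1 : ℝ) ≤ j := by exact_mod_cast Nat.one_le_iff_ne_zero.2 h
    have : Real.log 2 ≤ Real.log ((j : ℝ) + 1) := Real.log_le_log (by norm_num) (by linarith)
    push_cast
    rw [one_div_mul_one_div, mul_comm (Real.log 2)]
    gcongr

lemma summable_one_div_mul_log_sq : Summable fun n : ℕ => 1 / ((n : ℝ) * Real.log n ^ 2) := by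
  rw [← summable_condensed_iff_of_eventually_nonneg]
  · have h : Summable fun k : ℕ => (1 / Real.log 2 ^ 2) * (1 / (k : ℝ) ^ 2) :=
      (Real.summable_one_div_nat_pow.2 one_lt_two).mul_left _
    refine h.congr fun k => ?_
    push_cast
    rw [Real.log_pow, mul_pow]
    field_simp
  · exact Eventually.of_forall fun n => by positivity
  -- Monotonicity can only hold from 2 on: at 0 and 1 the term is a division by zero, with value 0.
  · filter_upwards [eventually_ge_atTop 2] with k hk
    have hk' : (2 : ℝ) ≤ k := by exact_mod_cast hk
    have : 0 < Real.log k := Real.log_pos (by linarith)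
    push_cast
    gcongr <;> linarith

/-- With `k = j + 1` the power `k ^ γ` cancels and leaves `1 / (√k log k)`, whose square is the
borderline summable term. -/
lemma noiseEigenvalue_weighted_summable (γ : ℝ) :
    Summable fun j : ℕ => ((((j : ℝ) + 1) ^ 2) ^ (γ / 2) * noiseEigenvalue γ j) ^ 2 := by
  refine ((summable_nat_add_iff 1).2 summable_one_div_mul_log_sq).of_nonneg_of_le
    (fun j => sq_nonneg _) fun j => ?_
  rw [noiseEigenvalue]
  split_ifs with h
  · simp; positivity
  · have hj : (0 : ℝ) < (j : ℝ) + 1 := by positivity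
    apply le_of_eq
    push_cast
    rw [← Real.rpow_natCast ((j : ℝ) + 1) 2, ← Real.rpow_mul hj.le, Real.rpow_add hj]
    push_cast
    rw [mul_div_cancel₀ γ (by norm_num : (2 : ℝ) ≠ 0), ← Real.sqrt_eq_rpow]
    have h3 := (Real.rpow_pos_of_pos hj γ).ne'
    rw [mul_one_div, mul_assoc, div_mul_cancel_left₀ h3, inv_pow, mul_pow, Real.sq_sqrt hj.le,
      one_div]

end Eigenvalues

end RealizedCovariation

namespace RealizedCovariation

/-! ### Action of the semigroup on eigenvectors -/

section Semigroup

variable {H : Type*} [NormedAddCommGroup H] [InnerProductSpace ℝ H] [CompleteSpace H]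

/-- `S y v - S x v = S x (S (y - x) v - v)` carries the generator limit from 0 to `x`. Only the
right derivative comes out this way. -/
lemma IsSemigroupGeneratedByNeg.hasDerivWithinAt {S : ℝ → H →L[ℝ] H} {A : H →ₗ.[ℝ] H}
    (hS : IsSemigroupGeneratedByNeg S A) {v w : H} (hvw : (v, w) ∈ A.graph) {x : ℝ} (hx : 0 ≤ x) :
    HasDerivWithinAt (fun t => S t v) (S x (-w)) (Set.Ici x) x := by
  rw [← hasDerivWithinAt_Ioi_iff_Ici, hasDerivWithinAt_iff_tendsto_slope' Set.self_notMem_Ioi]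
  obtain ⟨hv, hw⟩ := exists_apply_eq_of_mem_graph hvw
  have h0 := (hS.generator v (-w)).2 ⟨hv, by rw [hw]⟩
  have h1 : Tendsto (fun y : ℝ => y - x) (𝓝[>] x) (𝓝[>] 0) := by
    refine tendsto_nhdsWithin_iff.2 ⟨?_, ?_⟩
    · have : Tendsto (fun y : ℝ => y - x) (𝓝 x) (𝓝 (x - x)) := (continuous_sub_right x).tendsto x
      rw [sub_self] at this
      exact this.mono_left nhdsWithin_le_nhds
    · filter_upwards [self_mem_nhdsWithin] with y hy
      exact Set.mem_Ioi.2 (sub_pos.2 (Set.mem_Ioi.1 hy))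
  refine (((S x).continuous.tendsto _).comp (h0.comp h1)).congr' ?_
  filter_upwards [self_mem_nhdsWithin] with y hy
  have hy' : 0 ≤ y - x := (sub_pos.2 (Set.mem_Ioi.1 hy)).le
  have := hS.add x (y - x) hx hy'
  rw [add_sub_cancel] at this
  simp only [Function.comp, slope, vsub_eq_sub, this, ContinuousLinearMap.comp_apply, map_smul,
    map_sub]

/-- `exp (l x) • S x v` is continuous with vanishing right derivative, hence constant. -/
lemma IsSemigroupGeneratedByNeg.apply_eigenvector {S : ℝ → H →L[ℝ] H} {A : H →ₗ.[ℝ] H}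
    (hS : IsSemigroupGeneratedByNeg S A) {v : H} {l : ℝ} (hv : (v, l • v) ∈ A.graph)
    {t : ℝ} (ht : 0 ≤ t) : S t v = Real.exp (-(l * t)) • v := by
  have hE : ∀ x : ℝ, HasDerivAt (fun x => Real.exp (l * x)) (Real.exp (l * x) * l) x := by
    intro x
    simpa using ((hasDerivAt_id x).const_mul l).exp
  have key := constant_of_has_deriv_right_zero (a := 0) (b := t)
    (f := fun x => Real.exp (l * x) • S x v) ?_ ?_ t ⟨ht, le_rfl⟩
  · simp only [mul_zero, Real.exp_zero, hS.zero, ContinuousLinearMap.id_apply, one_smul] at key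
    rw [← key, smul_smul, ← Real.exp_add, key]
    simp
  · refine ContinuousOn.smul (by fun_prop) ((hS.continuousOn v).mono Set.Icc_subset_Ici_self)
  · intro x hx
    have h := (hE x).hasDerivWithinAt (s := Set.Ici x) |>.smul (hS.hasDerivWithinAt hv hx.1)
    convert! h using 1
    rw [map_neg, map_smul, smul_neg, smul_smul, neg_add_cancel]

lemma IsSemigroupGeneratedByNeg.adjoint_basis {S : ℝ → H →L[ℝ] H} {e : HilbertBasis ℕ ℝ H}
    {l : ℕ → ℝ} (hS : IsSemigroupGeneratedByNeg S (diagOp e l)) (k : ℕ) {t : ℝ} (ht : 0 ≤ t) :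
    ContinuousLinearMap.adjoint (S t) (e k) = Real.exp (-(l k * t)) • e k := by
  refine ext_inner_basis e fun j => ?_
  rw [ContinuousLinearMap.adjoint_inner_right,
    hS.apply_eigenvector (basis_mem_graph_diagOp e l j) ht, real_inner_smul_left, inner_smul_right,
    inner_basis_basis]
  split_ifs with h
  · rw [h]
  · simp

lemma IsSemigroupGeneratedByNeg.inner_basis_apply {S : ℝ → H →L[ℝ] H} {e : HilbertBasis ℕ ℝ H}
    {l : ℕ → ℝ} (hS : IsSemigroupGeneratedByNeg S (diagOp e l)) (k : ℕ) {t : ℝ} (ht : 0 ≤ t)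
    (v : H) : ⟪e k, S t v⟫ = Real.exp (-(l k * t)) * ⟪e k, v⟫ := by
  rw [← ContinuousLinearMap.adjoint_inner_left, hS.adjoint_basis k ht, real_inner_smul_left]

end Semigroup

end RealizedCovariation

namespace RealizedCovariation

/-! ### Covariances of increments and the Itô isometry for step integrands -/

section Isometry

variable {H : Type*} [NormedAddCommGroup H] [InnerProductSpace ℝ H] [CompleteSpace H]
variable {Ω : Type*} {mΩ : MeasurableSpace Ω} {P : Measure Ω} [IsProbabilityMeasure P]
variable {W : ℝ≥0 → Ω → H} {Q : H →L[ℝ] H} {ℱ : Filtration ℝ≥0 mΩ}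

lemma IsQWiener.measurable_inner (hW : IsQWiener W Q ℱ P) (s t : ℝ≥0) (u : H) :
    Measurable fun ω => ⟪W t ω - W s ω, u⟫ :=
  ((((hW.adapted t).mono (ℱ.le t)).sub ((hW.adapted s).mono (ℱ.le s))).inner
    stronglyMeasurable_const).measurable

lemma IsQWiener.memLp_inner (hW : IsQWiener W Q ℱ P) {s t : ℝ≥0} (hst : s ≤ t) (u : H) :
    MemLp (fun ω => ⟪W t ω - W s ω, u⟫) 2 P := by
  have h := memLp_id_gaussianReal' (μ := 0)
    (v := Real.toNNReal (((t : ℝ) - s) * ⟪Q u, u⟫)) 2 (by norm_num)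
  rw [← hW.gaussian s t hst u] at h
  exact (memLp_map_measure_iff h.1 (hW.measurable_inner s t u).aemeasurable).1 h

lemma IsQWiener.integral_inner (hW : IsQWiener W Q ℱ P) {s t : ℝ≥0} (hst : s ≤ t) (u : H) :
    ∫ ω, ⟪W t ω - W s ω, u⟫ ∂P = 0 := by
  have h := integral_id_gaussianReal (μ := 0) (v := Real.toNNReal (((t : ℝ) - s) * ⟪Q u, u⟫))
  rw [← hW.gaussian s t hst u, integral_map (hW.measurable_inner s t u).aemeasurable (by fun_prop)]
    at h
  exact h

lemma IsQWiener.integral_inner_sq (hW : IsQWiener W Q ℱ P) (hQ : Q.IsPositive) {s t : ℝ≥0}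
    (hst : s ≤ t) (u : H) :
    ∫ ω, ⟪W t ω - W s ω, u⟫ ^ 2 ∂P = ((t : ℝ) - s) * ⟪Q u, u⟫ := by
  have h := variance_id_gaussianReal (μ := 0) (v := Real.toNNReal (((t : ℝ) - s) * ⟪Q u, u⟫))
  rw [variance_of_integral_eq_zero (by fun_prop) (by simp), ← hW.gaussian s t hst u,
    integral_map (hW.measurable_inner s t u).aemeasurable (by fun_prop)] at h
  simp only [id] at h
  rw [h, Real.coe_toNNReal]
  have : (s : ℝ) ≤ t := hst
  exact mul_nonneg (by linarith) (hQ.inner_nonneg_left u)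

lemma IsQWiener.integral_inner_mul_inner (hW : IsQWiener W Q ℱ P) (hQ : Q.IsPositive) {s t : ℝ≥0}
    (hst : s ≤ t) (u v : H) :
    ∫ ω, ⟪W t ω - W s ω, u⟫ * ⟪W t ω - W s ω, v⟫ ∂P = ((t : ℝ) - s) * ⟪Q u, v⟫ := by
  have hsymm : ⟪Q v, u⟫ = ⟪Q u, v⟫ := by
    rw [real_inner_comm]
    exact (hQ.isSymmetric u v).symm
  have hint := fun w => (hW.memLp_inner hst w).integrable_sq
  have h : ∀ ω, ⟪W t ω - W s ω, u⟫ * ⟪W t ω - W s ω, v⟫ =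
      (⟪W t ω - W s ω, u + v⟫ ^ 2 - ⟪W t ω - W s ω, u⟫ ^ 2 - ⟪W t ω - W s ω, v⟫ ^ 2) / 2 := by
    intro ω
    rw [inner_add_right]
    ring
  simp_rw [h]
  have hint2 : Integrable
      (fun ω => ⟪W t ω - W s ω, u + v⟫ ^ 2 - ⟪W t ω - W s ω, u⟫ ^ 2) P := (hint _).sub (hint _)
  rw [integral_div, integral_sub hint2 (hint _), integral_sub (hint _) (hint _),
    hW.integral_inner_sq hQ hst, hW.integral_inner_sq hQ hst, hW.integral_inner_sq hQ hst,
    map_add, inner_add_left, inner_add_right, inner_add_right, hsymm]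
  ring

lemma IsQWiener.integral_mul_inner (hW : IsQWiener W Q ℱ P) {s t : ℝ≥0} (hst : s ≤ t)
    {g : Ω → ℝ} (hg : StronglyMeasurable[ℱ s] g) (u : H) :
    ∫ ω, g ω * ⟪W t ω - W s ω, u⟫ ∂P = 0 := by
  -- Independence is given for the `H`-valued increment; a scalar projection generates a smaller
  -- σ-algebra.
  have hle : MeasurableSpace.comap (fun ω => ⟪W t ω - W s ω, u⟫) inferInstance ≤
      MeasurableSpace.comap (fun ω => W t ω - W s ω) (borel H) := by
    let : MeasurableSpace H := borel H
    have : BorelSpace H := ⟨rfl⟩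
    have hc : Measurable fun x : H => ⟪x, u⟫ := (by fun_prop : Continuous fun x : H => ⟪x, u⟫).measurable
    change MeasurableSpace.comap ((fun x : H => ⟪x, u⟫) ∘ fun ω => W t ω - W s ω) _ ≤ _
    rw [← MeasurableSpace.comap_comp]
    exact MeasurableSpace.comap_mono hc.comap_le
  have hind : IndepFun (fun ω => ⟪W t ω - W s ω, u⟫) g P :=
    indep_of_indep_of_le_left (indep_of_indep_of_le_right (hW.indep s t hst)
      hg.measurable.comap_le) hle
  have := hind.symm.integral_fun_mul_eq_mul_integral
    (hg.mono (ℱ.le s)).aestronglyMeasurable (hW.measurable_inner s t u).aestronglyMeasurable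
  rw [this, hW.integral_inner hst, mul_zero]

/-- Splitting the longer increment at the earlier time leaves a covariance on the common interval
and a product with an independent centred increment. -/
lemma IsQWiener.integral_inner_zero_mul_inner_zero (hW : IsQWiener W Q ℱ P) (hQ : Q.IsPositive)
    (s t : ℝ≥0) (u v : H) :
    ∫ ω, ⟪W s ω - W 0 ω, u⟫ * ⟪W t ω - W 0 ω, v⟫ ∂P = min (s : ℝ) t * ⟪Q u, v⟫ := by
  wlog hst : s ≤ t generalizing s t u v
  · have h := this t s v u (le_of_not_ge hst)
    rw [min_comm, real_inner_comm]
    rw [show ⟪Q v, u⟫ = ⟪v, Q u⟫ from hQ.isSymmetric v u] at h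
    rw [← h]
    exact integral_congr_ae (Eventually.of_forall fun ω => mul_comm _ _)
  have hst' : (s : ℝ) ≤ t := hst
  have h : ∀ ω, ⟪W s ω - W 0 ω, u⟫ * ⟪W t ω - W 0 ω, v⟫ =
      ⟪W s ω - W 0 ω, u⟫ * ⟪W s ω - W 0 ω, v⟫ + ⟪W s ω - W 0 ω, u⟫ * ⟪W t ω - W s ω, v⟫ := by
    intro ω
    rw [← mul_add, ← inner_add_left]
    congr 2
    abel
  simp_rw [h]
  rw [integral_add, hW.integral_inner_mul_inner hQ zero_le, hW.integral_mul_inner hst]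
  · simp [min_eq_left hst']
  · exact ((hW.adapted s).sub ((hW.adapted 0).mono (ℱ.mono zero_le))).inner
      stronglyMeasurable_const
  · exact (hW.memLp_inner zero_le u).integrable_mul (hW.memLp_inner zero_le v)
  · exact (hW.memLp_inner zero_le u).integrable_mul (hW.memLp_inner hst v)

lemma volume_real_Ioc_inter_Ioc {a b c d : ℝ} (hab : a ≤ b) (hcd : c ≤ d) :
    volume.real (Set.Ioc a b ∩ Set.Ioc c d) = min b d - min a d - min b c + min a c := by
  rw [Set.Ioc_inter_Ioc, Real.volume_real_Ioc]
  grind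

lemma IsQWiener.integral_inner_increment_mul (hW : IsQWiener W Q ℱ P) (hQ : Q.IsPositive)
    {a b c d : ℝ≥0} (hab : a ≤ b) (hcd : c ≤ d) (u v : H) :
    ∫ ω, ⟪W b ω - W a ω, u⟫ * ⟪W d ω - W c ω, v⟫ ∂P =
      volume.real (Set.Ioc (a : ℝ) b ∩ Set.Ioc (c : ℝ) d) * ⟪Q u, v⟫ := by
  rw [volume_real_Ioc_inter_Ioc (NNReal.coe_le_coe.2 hab) (NNReal.coe_le_coe.2 hcd)]
  have hint : ∀ s t : ℝ≥0,
      Integrable (fun ω => ⟪W s ω - W 0 ω, u⟫ * ⟪W t ω - W 0 ω, v⟫) P := fun s t => (hW.memLp_inner zero_le u).integrable_mul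
    (hW.memLp_inner zero_le v)
  have hint2 : Integrable (fun ω => ⟪W b ω - W 0 ω, u⟫ * ⟪W d ω - W 0 ω, v⟫ -
      ⟪W a ω - W 0 ω, u⟫ * ⟪W d ω - W 0 ω, v⟫) P := (hint _ _).sub (hint _ _)
  have hint3 : Integrable (fun ω => ⟪W b ω - W 0 ω, u⟫ * ⟪W d ω - W 0 ω, v⟫ -
      ⟪W a ω - W 0 ω, u⟫ * ⟪W d ω - W 0 ω, v⟫ - ⟪W b ω - W 0 ω, u⟫ * ⟪W c ω - W 0 ω, v⟫) P :=
    hint2.sub (hint _ _)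
  have h : ∀ ω, ⟪W b ω - W a ω, u⟫ * ⟪W d ω - W c ω, v⟫ =
      ⟪W b ω - W 0 ω, u⟫ * ⟪W d ω - W 0 ω, v⟫ - ⟪W a ω - W 0 ω, u⟫ * ⟪W d ω - W 0 ω, v⟫ -
      ⟪W b ω - W 0 ω, u⟫ * ⟪W c ω - W 0 ω, v⟫ + ⟪W a ω - W 0 ω, u⟫ * ⟪W c ω - W 0 ω, v⟫ := by
    intro ω
    simp only [inner_sub_left]
    ring
  simp_rw [h]
  rw [integral_add hint3 (hint _ _), integral_sub hint2 (hint _ _),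
    integral_sub (hint _ _) (hint _ _)]
  simp only [hW.integral_inner_zero_mul_inner_zero hQ]
  ring

lemma eLpNorm_two_sq_eq_ofReal {α E : Type*} {m : MeasurableSpace α} {μ : Measure α}
    [NormedAddCommGroup E] {f : α → E} (hf : MemLp f 2 μ) :
    eLpNorm f 2 μ ^ 2 = ENNReal.ofReal (∫ x, ‖f x‖ ^ 2 ∂μ) := by
  rw [hf.eLpNorm_eq_integral_rpow_norm (by norm_num) (by norm_num),
    ← ENNReal.ofReal_pow (by positivity)]
  congr 1
  rw [← Real.rpow_natCast, ← Real.rpow_mul (by positivity)]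
  simp

/-- The Itô isometry for scalar Wiener integrals of step functions. -/
lemma IsQWiener.eLpNorm_sum_inner_increment (hW : IsQWiener W Q ℱ P) {R : H →L[ℝ] H}
    (hR : R.IsPositive) (hRQ : R ∘L R = Q) {κ : Type*} [Fintype κ] {a b : κ → ℝ≥0}
    (hab : ∀ i, a i ≤ b i) (v : κ → H) :
    eLpNorm (fun ω => ∑ i, ⟪W (b i) ω - W (a i) ω, v i⟫) 2 P =
      eLpNorm (fun s : ℝ => ∑ i, (Set.Ioc (a i : ℝ) (b i)).indicator (fun _ => R (v i)) s) 2
        volume := by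
  have hRs : ∀ x y, ⟪R x, y⟫ = ⟪x, R y⟫ := fun x y => hR.isSymmetric x y
  have hQ : Q.IsPositive := by
    rw [← hRQ, ContinuousLinearMap.isPositive_def]
    refine ⟨fun x y => ?_, fun x => ?_⟩
    · change ⟪R (R x), y⟫ = ⟪x, R (R y)⟫
      rw [hRs, hRs]
    · change 0 ≤ ⟪R (R x), x⟫
      rw [hRs]
      exact real_inner_self_nonneg
  have hL : MemLp (fun ω => ∑ i, ⟪W (b i) ω - W (a i) ω, v i⟫) 2 P :=
    memLp_finsetSum _ fun i _ => hW.memLp_inner (hab i) (v i)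
  have hRm : MemLp (fun s : ℝ => ∑ i, (Set.Ioc (a i : ℝ) (b i)).indicator (fun _ => R (v i)) s) 2
      volume :=
    memLp_finsetSum _ fun i _ => memLp_indicator_const 2 measurableSet_Ioc _ (Or.inr (by simp))
  have hsq : eLpNorm (fun ω => ∑ i, ⟪W (b i) ω - W (a i) ω, v i⟫) 2 P ^ 2 =
      eLpNorm (fun s : ℝ => ∑ i, (Set.Ioc (a i : ℝ) (b i)).indicator (fun _ => R (v i)) s) 2
        volume ^ 2 := by
    rw [eLpNorm_two_sq_eq_ofReal hL, eLpNorm_two_sq_eq_ofReal hRm]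
    congr 1
    have h1 : ∀ ω, ‖∑ i, ⟪W (b i) ω - W (a i) ω, v i⟫‖ ^ 2 =
        ∑ i, ∑ j, ⟪W (b i) ω - W (a i) ω, v i⟫ * ⟪W (b j) ω - W (a j) ω, v j⟫ := by
      intro ω
      rw [Real.norm_eq_abs, sq_abs, sq, Finset.sum_mul_sum]
    -- The intervals may overlap, so both squared norms are expanded over all pairs; the covariance
    -- of two increments matches the length of the intersection.
    have h2 : ∀ s : ℝ,
        ‖∑ i, (Set.Ioc (a i : ℝ) (b i)).indicator (fun _ => R (v i)) s‖ ^ 2 =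
        ∑ i, ∑ j, (Set.Ioc (a i : ℝ) (b i) ∩ Set.Ioc (a j : ℝ) (b j)).indicator
          (fun _ => ⟪Q (v i), v j⟫) s := by
      intro s
      rw [← real_inner_self_eq_norm_sq, sum_inner]
      refine Finset.sum_congr rfl fun i _ => ?_
      rw [inner_sum]
      refine Finset.sum_congr rfl fun j _ => ?_
      rw [← hRQ, ContinuousLinearMap.comp_apply, hRs]
      by_cases hi : s ∈ Set.Ioc (a i : ℝ) (b i) <;> by_cases hj : s ∈ Set.Ioc (a j : ℝ) (b j) <;>
        simp only [Set.indicator_apply, Set.mem_inter_iff, hi, hj, and_self, and_false, false_and,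
          if_true, if_false, inner_zero_left, inner_zero_right]
    have hfin : ∀ i j, volume (Set.Ioc (a i : ℝ) (b i) ∩ Set.Ioc (a j : ℝ) (b j)) ≠ ∞ :=
      fun i j => ((measure_mono Set.inter_subset_left).trans_lt (by simp)).ne
    have hi1 : ∀ i j, Integrable
        (fun ω => ⟪W (b i) ω - W (a i) ω, v i⟫ * ⟪W (b j) ω - W (a j) ω, v j⟫) P := fun i j =>
      (hW.memLp_inner (hab i) _).integrable_mul (hW.memLp_inner (hab j) _)
    have hi2 : ∀ i j, Integrable ((Set.Ioc (a i : ℝ) (b i) ∩ Set.Ioc (a j : ℝ) (b j)).indicator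
          (fun _ => ⟪Q (v i), v j⟫)) volume := fun i j =>
      (integrable_indicator_iff (measurableSet_Ioc.inter measurableSet_Ioc)).2
        (integrableOn_const (hfin i j))
    simp_rw [h1, h2]
    rw [integral_finsetSum _ fun i _ => integrable_finsetSum _ fun j _ => hi1 i j,
      integral_finsetSum _ fun i _ => integrable_finsetSum _ fun j _ => hi2 i j]
    refine Finset.sum_congr rfl fun i _ => ?_
    rw [integral_finsetSum _ fun j _ => hi1 i j, integral_finsetSum _ fun j _ => hi2 i j]
    refine Finset.sum_congr rfl fun j _ => ?_
    rw [hW.integral_inner_increment_mul hQ (hab i) (hab j),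
      integral_indicator_const _ (measurableSet_Ioc.inter measurableSet_Ioc), smul_eq_mul]
  exact (ENNReal.pow_right_strictMono two_ne_zero).injective hsq

/-- Step integrals are orthogonal to `ℱ₀`-measurable random variables. -/
lemma IsQWiener.eLpNorm_add_sum_inner_increment_sq (hW : IsQWiener W Q ℱ P) {g : Ω → ℝ}
    (hg : StronglyMeasurable[ℱ 0] g) (hg2 : MemLp g 2 P) {κ : Type*} [Fintype κ] {a b : κ → ℝ≥0}
    (hab : ∀ i, a i ≤ b i) (v : κ → H) :
    eLpNorm (fun ω => g ω + ∑ i, ⟪W (b i) ω - W (a i) ω, v i⟫) 2 P ^ 2 =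
      eLpNorm g 2 P ^ 2 + eLpNorm (fun ω => ∑ i, ⟪W (b i) ω - W (a i) ω, v i⟫) 2 P ^ 2 := by
  have hL : MemLp (fun ω => ∑ i, ⟪W (b i) ω - W (a i) ω, v i⟫) 2 P :=
    memLp_finsetSum _ fun i _ => hW.memLp_inner (hab i) (v i)
  rw [eLpNorm_two_sq_eq_ofReal hL, eLpNorm_two_sq_eq_ofReal hg2,
    eLpNorm_two_sq_eq_ofReal (f := fun ω => g ω + ∑ i, ⟪W (b i) ω - W (a i) ω, v i⟫) (hg2.add hL),
    ← ENNReal.ofReal_add (integral_nonneg fun _ => sq_nonneg _) (integral_nonneg fun _ => sq_nonneg _)]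
  congr 1
  -- Every increment starts at a time `≥ 0`, hence is centred and independent of `ℱ 0`.
  have hcross : ∫ ω, g ω * ∑ i, ⟪W (b i) ω - W (a i) ω, v i⟫ ∂P = 0 := by
    simp_rw [Finset.mul_sum]
    have hi (i : κ) : Integrable (fun ω => g ω * ⟪W (b i) ω - W (a i) ω, v i⟫) P :=
      hg2.integrable_mul (hW.memLp_inner (hab i) (v i))
    rw [integral_finsetSum _ fun i _ => hi i]
    exact Finset.sum_eq_zero fun i _ =>
      hW.integral_mul_inner (hab i) (hg.mono (ℱ.mono zero_le)) _
  simp only [Real.norm_eq_abs, sq_abs]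
  have h : ∀ ω, (g ω + ∑ i, ⟪W (b i) ω - W (a i) ω, v i⟫) ^ 2 = g ω ^ 2 +
      (∑ i, ⟪W (b i) ω - W (a i) ω, v i⟫) ^ 2 +
      2 * (g ω * ∑ i, ⟪W (b i) ω - W (a i) ω, v i⟫) := fun ω => by ring
  simp_rw [h]
  have hi3 : Integrable (fun ω => g ω * ∑ i, ⟪W (b i) ω - W (a i) ω, v i⟫) P :=
    hg2.integrable_mul hL
  have hi4 : Integrable (fun ω => g ω ^ 2 + (∑ i, ⟪W (b i) ω - W (a i) ω, v i⟫) ^ 2) P :=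
    hg2.integrable_sq.add hL.integrable_sq
  rw [integral_add hi4 (hi3.const_mul 2),
    integral_add hg2.integrable_sq hL.integrable_sq, integral_const_mul, hcross]
  ring

end Isometry

end RealizedCovariation

namespace RealizedCovariation

/-! ### Coordinates of the stochastic convolution -/

section WienerIntegral

variable {H : Type*} [NormedAddCommGroup H] [InnerProductSpace ℝ H] [CompleteSpace H]

lemma eLpNorm_two_sq {α E : Type*} {m : MeasurableSpace α} {μ : Measure α}
    [NormedAddCommGroup E] (f : α → E) :
    eLpNorm f 2 μ ^ 2 = ∫⁻ x, ‖f x‖ₑ ^ 2 ∂μ := by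
  have := eLpNorm_nnreal_pow_eq_lintegral (f := f) (μ := μ) (p := 2) two_ne_zero
  simp only [ENNReal.coe_ofNat, NNReal.coe_ofNat] at this
  exact_mod_cast this

lemma tendsto_zero_of_sq {a : ℕ → ℝ≥0∞} (h : Tendsto (fun n => a n ^ 2) atTop (𝓝 0)) :
    Tendsto a atTop (𝓝 0) := by
  have h2 := (ENNReal.continuous_rpow_const (y := 1 / 2)).tendsto 0 |>.comp h
  rw [ENNReal.zero_rpow_of_pos (by norm_num)] at h2
  refine h2.congr fun n => ?_
  rw [Function.comp, ← ENNReal.rpow_natCast, ← ENNReal.rpow_mul]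
  simp

lemma hsNorm_sq {ι : Type*} (b : HilbertBasis ι ℝ H) (B : H →L[ℝ] H) :
    hsNorm B ^ 2 = ∑' i, ‖B (b i)‖ₑ ^ 2 := by
  rw [hsNorm_eq b, ← ENNReal.rpow_natCast, ← ENNReal.rpow_mul]
  simp

lemma enorm_adjoint_basis_sq_le {ι : Type*} (b : HilbertBasis ι ℝ H) (B : H →L[ℝ] H) (k : ι) :
    ‖ContinuousLinearMap.adjoint B (b k)‖ₑ ^ 2 ≤ hsNorm B ^ 2 := by
  rw [hsNorm_sq b, tsum_enorm_sq_adjoint b b]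
  exact ENNReal.le_tsum k

/-- Both squared norms are `⟪R² v, v⟫`. Each Wiener integral carries its own square root of `Q`;
this lets them be exchanged without appealing to uniqueness. -/
lemma norm_eq_of_comp_self_eq {R R' : H →L[ℝ] H} (hR : R.IsPositive) (hR' : R'.IsPositive)
    (h : R ∘L R = R' ∘L R') (v : H) : ‖R v‖ = ‖R' v‖ := by
  have h1 : ‖R v‖ ^ 2 = ‖R' v‖ ^ 2 := by
    rw [← real_inner_self_eq_norm_sq, ← real_inner_self_eq_norm_sq]
    calc ⟪R v, R v⟫ = ⟪(R ∘L R) v, v⟫ := (hR.isSymmetric (R v) v).symm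
      _ = ⟪R' v, R' v⟫ := by rw [h]; exact hR'.isSymmetric (R' v) v
  exact (sq_eq_sq₀ (norm_nonneg _) (norm_nonneg _)).1 h1

/-- The kernel `exp (-l (t - s))`, `0 < s ≤ t`, of the stochastic convolution, extended by zero. -/
noncomputable def expKernel (l t : ℝ) : ℝ → ℝ :=
  (Set.Ioc 0 t).indicator fun s => Real.exp (-(l * (t - s)))

lemma expKernel_measurable (l t : ℝ) : Measurable (expKernel l t) :=
  Measurable.indicator (by fun_prop) measurableSet_Ioc

lemma lintegral_exp_sq_Ioc {l c d : ℝ} (hl : 0 < l) (hcd : c ≤ d) :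
    ∫⁻ s in Set.Ioc c d, ENNReal.ofReal (Real.exp (-(l * (d - s))) ^ 2) =
      ENNReal.ofReal ((1 - Real.exp (-(l * (d - c))) ^ 2) / (2 * l)) := by
  have hcont : Continuous fun s => Real.exp (-(l * (d - s))) ^ 2 := by fun_prop
  rw [← ofReal_integral_eq_lintegral_ofReal
    ((hcont.integrableOn_Icc).mono_set Set.Ioc_subset_Icc_self)
    (Eventually.of_forall fun s => sq_nonneg _), ← intervalIntegral.integral_of_le hcd]
  congr 1
  have hderiv : ∀ s ∈ Set.uIcc c d,
      HasDerivAt (fun s => Real.exp (-(l * (d - s))) ^ 2 / (2 * l))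
        (Real.exp (-(l * (d - s))) ^ 2) s := by
    intro s _
    have h1 : HasDerivAt (fun s => -(l * (d - s))) l s := by
      have := (((hasDerivAt_id s).const_sub d).const_mul l).fun_neg
      simpa using this
    have h2 := (h1.exp.pow 2).div_const (2 * l)
    convert! h2 using 1
    field_simp
    simp
    ring
  rw [intervalIntegral.integral_eq_sub_of_hasDerivAt hderiv (hcont.intervalIntegrable _ _)]
  simp
  ring

/-- Put `a = exp (-l (t' - t))`, `b = exp (-l t)`. The difference is `(a - 1) exp (-l (t - s))` on
`(0, t]` and `exp (-l (t' - s))` on `(t, t']`, so the integral is `((1 - a)² (1 - b²) + 1 - a²) /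
(2l)`. Dropping `b` gives `(1 - a) / l`, the stationary value. -/
lemma lintegral_expKernel_sub_sq_le {l t t' : ℝ} (hl : 0 < l) (ht : 0 ≤ t) (htt' : t ≤ t') :
    ∫⁻ s, ENNReal.ofReal ((expKernel l t' s - expKernel l t s) ^ 2) ≤
      ENNReal.ofReal ((1 - Real.exp (-(l * (t' - t)))) / l) := by
  set a := Real.exp (-(l * (t' - t))) with ha
  have ha0 : 0 < a := Real.exp_pos _
  have ha1 : a ≤ 1 := by
    rw [ha, Real.exp_le_one_iff]
    have := mul_nonneg hl.le (sub_nonneg.2 htt')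
    linarith
  have hb : 0 < Real.exp (-(l * (t - 0))) := Real.exp_pos _
  have hb1 : Real.exp (-(l * (t - 0))) ≤ 1 := by
    rw [Real.exp_le_one_iff]
    have := mul_nonneg hl.le ht
    linarith
  have hpt : ∀ s, ENNReal.ofReal ((expKernel l t' s - expKernel l t s) ^ 2) ≤
      (Set.Ioc 0 t).indicator
        (fun s => ENNReal.ofReal ((1 - a) ^ 2) * ENNReal.ofReal (Real.exp (-(l * (t - s))) ^ 2)) s +
      (Set.Ioc t t').indicator (fun s => ENNReal.ofReal (Real.exp (-(l * (t' - s))) ^ 2)) s := by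
    intro s
    by_cases h1 : s ∈ Set.Ioc 0 t
    · have h2 : s ∈ Set.Ioc 0 t' := ⟨h1.1, h1.2.trans htt'⟩
      rw [expKernel, expKernel, Set.indicator_of_mem h2, Set.indicator_of_mem h1,
        Set.indicator_of_mem h1, ← ENNReal.ofReal_mul (sq_nonneg _), ← mul_pow]
      refine le_add_right (le_of_eq ?_)
      congr 1
      have : Real.exp (-(l * (t' - s))) = a * Real.exp (-(l * (t - s))) := by
        rw [ha, ← Real.exp_add]
        congr 1
        ring
      rw [this]
      ring
    · by_cases h2 : s ∈ Set.Ioc t t'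
      · have h3 : s ∈ Set.Ioc 0 t' := ⟨ht.trans_lt h2.1, h2.2⟩
        rw [expKernel, expKernel, Set.indicator_of_mem h3,
          Set.indicator_of_notMem h1, Set.indicator_of_notMem h1, Set.indicator_of_mem h2, sub_zero,
          zero_add]
      · have h3 : s ∉ Set.Ioc 0 t' := by
          intro h3
          rcases le_or_gt s t with h | h
          · exact h1 ⟨h3.1, h⟩
          · exact h2 ⟨h, h3.2⟩
        rw [expKernel, expKernel, Set.indicator_of_notMem h3, Set.indicator_of_notMem h1]
        simp
  calc ∫⁻ s, ENNReal.ofReal ((expKernel l t' s - expKernel l t s) ^ 2)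
      ≤ ENNReal.ofReal ((1 - a) ^ 2) *
          ENNReal.ofReal ((1 - Real.exp (-(l * (t - 0))) ^ 2) / (2 * l)) +
        ENNReal.ofReal ((1 - a ^ 2) / (2 * l)) := by
        refine (lintegral_mono hpt).trans (le_of_eq ?_)
        rw [lintegral_add_right _ (Measurable.indicator (by fun_prop) measurableSet_Ioc),
          lintegral_indicator measurableSet_Ioc, lintegral_indicator measurableSet_Ioc,
          lintegral_const_mul _ (by fun_prop), lintegral_exp_sq_Ioc hl ht,
          lintegral_exp_sq_Ioc hl htt']
    _ ≤ _ := by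
        rw [← ENNReal.ofReal_mul (sq_nonneg _), ← ENNReal.ofReal_add]
        · apply ENNReal.ofReal_le_ofReal
          rw [mul_div_assoc', ← add_div, div_le_div_iff₀ (by positivity) hl]
          have : 0 ≤ (1 - a) ^ 2 * Real.exp (-(l * (t - 0))) ^ 2 := by positivity
          nlinarith
        · have : 0 ≤ 1 - Real.exp (-(l * (t - 0))) ^ 2 := by nlinarith
          positivity
        · have : 0 ≤ 1 - a ^ 2 := by nlinarith
          positivity

lemma eLpNorm_expKernel_sub_smul_sq_le {l t t' : ℝ} (hl : 0 < l) (ht : 0 ≤ t) (htt' : t ≤ t')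
    (w : H) : eLpNorm (fun s => (expKernel l t' s - expKernel l t s) • w) 2 volume ^ 2 ≤
      ENNReal.ofReal (‖w‖ ^ 2 * ((1 - Real.exp (-(l * (t' - t)))) / l)) := by
  have h : ∀ s, ‖(expKernel l t' s - expKernel l t s) • w‖ₑ ^ 2 =
      ENNReal.ofReal (‖w‖ ^ 2) * ENNReal.ofReal ((expKernel l t' s - expKernel l t s) ^ 2) := by
    intro s
    rw [enorm_smul, mul_pow, mul_comm, ENNReal.ofReal_pow (norm_nonneg _), ofReal_norm,
      ← sq_abs (expKernel l t' s - expKernel l t s), ENNReal.ofReal_pow (abs_nonneg _),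
      ← Real.norm_eq_abs, ofReal_norm]
  rw [eLpNorm_two_sq]
  simp_rw [h]
  rw [lintegral_const_mul' _ _ ENNReal.ofReal_ne_top, ENNReal.ofReal_mul (sq_nonneg _)]
  gcongr
  exact lintegral_expKernel_sub_sq_le hl ht htt'

variable {Ω : Type*} {mΩ : MeasurableSpace Ω} {P : Measure Ω}
variable {W : ℝ≥0 → Ω → H} {Q : H →L[ℝ] H} {ℱ : Filtration ℝ≥0 mΩ}

lemma ElementaryIntegrand.inner_integral (Φ : ElementaryIntegrand H) (W : ℝ≥0 → Ω → H) (v : H)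
    (ω : Ω) : ⟪v, Φ.integral W ω⟫ =
      ∑ i, ⟪W (Φ.right i) ω - W (Φ.left i) ω, ContinuousLinearMap.adjoint (Φ.coeff i) v⟫ := by
  rw [ElementaryIntegrand.integral, inner_sum]
  refine Finset.sum_congr rfl fun i _ => ?_
  rw [ContinuousLinearMap.adjoint_inner_right, real_inner_comm]

lemma ElementaryIntegrand.apply_adjoint_eval (Φ : ElementaryIntegrand H) (R : H →L[ℝ] H) (v : H)
    (s : ℝ) : R (ContinuousLinearMap.adjoint (Φ.eval s) v) =
      ∑ i, (Set.Ioc (Φ.left i : ℝ) (Φ.right i)).indicator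
        (fun _ => R (ContinuousLinearMap.adjoint (Φ.coeff i) v)) s := by
  rw [ElementaryIntegrand.eval, map_sum, _root_.sum_apply, map_sum]
  refine Finset.sum_congr rfl fun i _ => ?_
  by_cases h : s ∈ Set.Ioc (Φ.left i : ℝ) (Φ.right i)
  · rw [if_pos h, Set.indicator_of_mem h]
  · rw [if_neg h, Set.indicator_of_notMem h]
    simp

/-- Coordinates of a stochastic convolution are approximated by scalar step integrals. -/
lemma IsWienerIntegral.exists_approx {S : ℝ → H →L[ℝ] H} {e : HilbertBasis ℕ ℝ H} {l : ℕ → ℝ}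
    (hS : IsSemigroupGeneratedByNeg S (diagOp e l)) {t : ℝ≥0} {Y : Ω → H}
    (hY : IsWienerIntegral W Q P t (fun s => S (t - s)) Y) {R : H →L[ℝ] H} (hR : R.IsPositive)
    (hRQ : R ∘L R = Q) (k : ℕ) :
    ∃ Φ : ℕ → ElementaryIntegrand H,
      Tendsto (fun n => eLpNorm (fun s : ℝ => ∑ i,
        (Set.Ioc ((Φ n).left i : ℝ) ((Φ n).right i)).indicator
          (fun _ => R (ContinuousLinearMap.adjoint ((Φ n).coeff i) (e k))) s -
            expKernel (l k) t s • R (e k)) 2 volume) atTop (𝓝 0) ∧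
      Tendsto (fun n => eLpNorm (fun ω => ∑ i, ⟪W ((Φ n).right i) ω - W ((Φ n).left i) ω,
        ContinuousLinearMap.adjoint ((Φ n).coeff i) (e k)⟫ - ⟪e k, Y ω⟫) 2 P) atTop (𝓝 0) := by
  obtain ⟨-, R', hR', hRQ', Φ, hΦ, h1, h2⟩ := hY
  refine ⟨Φ, tendsto_zero_of_sq ?_, ?_⟩
  · refine tendsto_of_tendsto_of_tendsto_of_le_of_le tendsto_const_nhds h1 (fun n => zero_le)
      fun n => ?_
    simp only
    rw [eLpNorm_two_sq, ← lintegral_indicator measurableSet_Ioc]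
    refine lintegral_mono fun s => ?_
    rw [← ElementaryIntegrand.apply_adjoint_eval, expKernel]
    by_cases hs : s ∈ Set.Ioc (0 : ℝ) t
    -- On `(0, t]` the scaled `e k` is the adjoint of `S (t - s)` at `e k`, so the difference is `R`
    -- applied to the adjoint of `Φ(s) - S (t - s)` at `e k`, one term of a Hilbert–Schmidt sum.
    · rw [Set.indicator_of_mem hs, Set.indicator_of_mem hs, ← map_smul, ← map_sub,
        ← hS.adjoint_basis k (sub_nonneg.2 hs.2), ← _root_.sub_apply, ← map_sub, ← ofReal_norm,
        norm_eq_of_comp_self_eq hR hR' (hRQ.trans hRQ'.symm), ofReal_norm]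
      have hadj : ∀ D : H →L[ℝ] H, R' (ContinuousLinearMap.adjoint D (e k)) =
          ContinuousLinearMap.adjoint (D ∘L R') (e k) := by
        intro D
        rw [ContinuousLinearMap.adjoint_comp, hR'.isSelfAdjoint.adjoint_eq,
          ContinuousLinearMap.comp_apply]
      rw [hadj]
      exact enorm_adjoint_basis_sq_le e _ k
    · rw [Set.indicator_of_notMem hs, Set.indicator_of_notMem hs, zero_smul, sub_zero,
        ElementaryIntegrand.apply_adjoint_eval, Finset.sum_eq_zero]
      · simp
      · intro i _
        refine Set.indicator_of_notMem (fun hi => hs ⟨(NNReal.coe_nonneg _).trans_lt hi.1,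
          hi.2.trans (NNReal.coe_le_coe.2 (hΦ n i))⟩) _
  · refine tendsto_of_tendsto_of_tendsto_of_le_of_le tendsto_const_nhds h2 (fun n => zero_le)
      fun n => ?_
    refine eLpNorm_mono fun ω => ?_
    rw [← ElementaryIntegrand.inner_integral, ← inner_sub_right]
    refine (norm_inner_le_norm _ _).trans ?_
    rw [e.orthonormal.1 k, one_mul]

variable [IsProbabilityMeasure P]

/-- Second moment bound for the increments of a coordinate of the stochastic convolution,
perturbed by an `ℱ₀`-measurable random variable. -/
lemma eLpNorm_add_inner_sub_inner_sq_le (hW : IsQWiener W Q ℱ P) {S : ℝ → H →L[ℝ] H}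
    {e : HilbertBasis ℕ ℝ H} {l : ℕ → ℝ} (hS : IsSemigroupGeneratedByNeg S (diagOp e l))
    {t t' : ℝ≥0} (htt' : t ≤ t') {Y Y' : Ω → H}
    (hY : IsWienerIntegral W Q P t (fun s => S (t - s)) Y)
    (hY' : IsWienerIntegral W Q P t' (fun s => S (t' - s)) Y') {k : ℕ} (hl : 0 < l k)
    {g : Ω → ℝ} (hg : StronglyMeasurable[ℱ 0] g) (hg2 : MemLp g 2 P) :
    eLpNorm (fun ω => g ω + (⟪e k, Y' ω⟫ - ⟪e k, Y ω⟫)) 2 P ^ 2 ≤ eLpNorm g 2 P ^ 2 +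
      ENNReal.ofReal (⟪Q (e k), e k⟫ * ((1 - Real.exp (-(l k * (t' - t)))) / l k)) := by
  obtain ⟨R, hR, hRQ⟩ : ∃ R : H →L[ℝ] H, R.IsPositive ∧ R ∘L R = Q := by
    obtain ⟨-, R, hR, hRQ, -⟩ := hY
    exact ⟨R, hR, hRQ⟩
  have hRe : ⟪Q (e k), e k⟫ = ‖R (e k)‖ ^ 2 := by
    rw [← real_inner_self_eq_norm_sq, ← hRQ]
    exact hR.isSymmetric (R (e k)) (e k)
  obtain ⟨Φ, hΦ1, hΦ2⟩ := hY.exists_approx hS hR hRQ k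
  obtain ⟨Ψ, hΨ1, hΨ2⟩ := hY'.exists_approx hS hR hRQ k
  set I : ElementaryIntegrand H → Ω → ℝ := fun Φ ω => ∑ i, ⟪W (Φ.right i) ω - W (Φ.left i) ω,
        ContinuousLinearMap.adjoint (Φ.coeff i) (e k)⟫ with hI
  set J : ElementaryIntegrand H → ℝ → H := fun Φ s => ∑ i,
        (Set.Ioc (Φ.left i : ℝ) (Φ.right i)).indicator
          (fun _ => R (ContinuousLinearMap.adjoint (Φ.coeff i) (e k))) s with hJ
  set δ : ℝ≥0∞ := eLpNorm (fun s => (expKernel (l k) t' s - expKernel (l k) t s) • R (e k)) 2 volume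
    with hδ
  have hδle : δ ^ 2 ≤
      ENNReal.ofReal (⟪Q (e k), e k⟫ * ((1 - Real.exp (-(l k * (t' - t)))) / l k)) := by
    rw [hRe]
    exact eLpNorm_expKernel_sub_smul_sq_le hl t.2 htt' _
  have hImem : ∀ Φ, MemLp (I Φ) 2 P := fun Φ =>
    memLp_finsetSum _ fun i _ => hW.memLp_inner (Φ.left_le_right i) _
  have hJm : ∀ Φ, AEStronglyMeasurable (J Φ) volume := fun Φ =>
    Finset.aestronglyMeasurable_fun_sum _ fun i _ =>
      aestronglyMeasurable_const.indicator measurableSet_Ioc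
  have hKm : ∀ t : ℝ, AEStronglyMeasurable (fun s => expKernel (l k) t s • R (e k)) volume :=
    fun t => ((expKernel_measurable (l k) t).stronglyMeasurable.smul_const _).aestronglyMeasurable
  have hYm : ∀ {t : ℝ≥0} {Z : Ω → H}, IsWienerIntegral W Q P t (fun s => S (t - s)) Z →
      AEStronglyMeasurable (fun ω => ⟪e k, Z ω⟫) P := fun h =>
    aestronglyMeasurable_const.inner h.1.aestronglyMeasurable
  -- both step integrands are merged into one family indexed by a sum type
  have hiso : ∀ n, eLpNorm (fun ω => g ω + (I (Ψ n) ω - I (Φ n) ω)) 2 P ^ 2 =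
      eLpNorm g 2 P ^ 2 + eLpNorm (fun s => J (Ψ n) s - J (Φ n) s) 2 volume ^ 2 := by
    intro n
    let a : Fin (Ψ n).n ⊕ Fin (Φ n).n → ℝ≥0 := Sum.elim (Ψ n).left (Φ n).left
    let b : Fin (Ψ n).n ⊕ Fin (Φ n).n → ℝ≥0 := Sum.elim (Ψ n).right (Φ n).right
    let v : Fin (Ψ n).n ⊕ Fin (Φ n).n → H :=
      Sum.elim (fun i => ContinuousLinearMap.adjoint ((Ψ n).coeff i) (e k))
        (fun i => -ContinuousLinearMap.adjoint ((Φ n).coeff i) (e k))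
    have hab : ∀ i, a i ≤ b i := by
      rintro (i | i)
      · exact (Ψ n).left_le_right i
      · exact (Φ n).left_le_right i
    have h1 : ∀ ω, ∑ i, ⟪W (b i) ω - W (a i) ω, v i⟫ = I (Ψ n) ω - I (Φ n) ω := by
      intro ω
      rw [Fintype.sum_sum_type]
      simp [a, b, v, I, sub_eq_add_neg]
    have h2 : ∀ s, ∑ i, (Set.Ioc (a i : ℝ) (b i)).indicator (fun _ => R (v i)) s =
        J (Ψ n) s - J (Φ n) s := by
      intro s
      rw [Fintype.sum_sum_type, sub_eq_add_neg, hJ]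
      simp only [a, b, v, Sum.elim_inl, Sum.elim_inr, ← Finset.sum_neg_distrib]
      congr 1
      refine Finset.sum_congr rfl fun i _ => ?_
      rw [map_neg, Set.indicator_apply, Set.indicator_apply]
      split_ifs <;> simp
    have h3 := hW.eLpNorm_add_sum_inner_increment_sq hg hg2 hab v
    rw [hW.eLpNorm_sum_inner_increment hR hRQ hab v] at h3
    simp_rw [h1, h2] at h3
    exact h3
  have hJle : ∀ n, eLpNorm (fun s => J (Ψ n) s - J (Φ n) s) 2 volume ≤
      eLpNorm (fun s => J (Ψ n) s - expKernel (l k) t' s • R (e k)) 2 volume + δ +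
        eLpNorm (fun s => J (Φ n) s - expKernel (l k) t s • R (e k)) 2 volume := by
    intro n
    have h1 : (fun s => J (Ψ n) s - J (Φ n) s) =
        (fun s => J (Ψ n) s - expKernel (l k) t' s • R (e k)) +
        (fun s => (expKernel (l k) t' s - expKernel (l k) t s) • R (e k)) -
        (fun s => J (Φ n) s - expKernel (l k) t s • R (e k)) := by
      ext s
      simp only [Pi.add_apply, Pi.sub_apply, sub_smul]
      abel
    have hm : AEStronglyMeasurable
        (fun s => (expKernel (l k) t' s - expKernel (l k) t s) • R (e k)) volume := by
      simp_rw [sub_smul]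
      exact (hKm _).sub (hKm _)
    rw [h1]
    refine (eLpNorm_sub_le (((hJm _).sub (hKm _)).add hm) ((hJm _).sub (hKm _))
      (by norm_num)).trans ?_
    exact add_le_add (eLpNorm_add_le ((hJm _).sub (hKm _)) hm (by norm_num)) le_rfl
  -- The term `g` and the step integrals combine in quadrature by orthogonality; the approximation
  -- errors enter only through the triangle inequality and vanish in the limit.
  have hmain : ∀ n, eLpNorm (fun ω => g ω + (⟪e k, Y' ω⟫ - ⟪e k, Y ω⟫)) 2 P ≤
      (eLpNorm g 2 P ^ 2 +
        (eLpNorm (fun s => J (Ψ n) s - expKernel (l k) t' s • R (e k)) 2 volume + δ +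
        eLpNorm (fun s => J (Φ n) s - expKernel (l k) t s • R (e k)) 2 volume) ^ 2) ^ (1 / 2 : ℝ) +
      eLpNorm (fun ω => I (Φ n) ω - ⟪e k, Y ω⟫) 2 P +
      eLpNorm (fun ω => I (Ψ n) ω - ⟪e k, Y' ω⟫) 2 P := by
    intro n
    have h1 : (fun ω => g ω + (⟪e k, Y' ω⟫ - ⟪e k, Y ω⟫)) =
        (fun ω => g ω + (I (Ψ n) ω - I (Φ n) ω)) + (fun ω => I (Φ n) ω - ⟪e k, Y ω⟫) -
        (fun ω => I (Ψ n) ω - ⟪e k, Y' ω⟫) := by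
      ext ω
      simp only [Pi.add_apply, Pi.sub_apply]
      ring
    have hm1 : AEStronglyMeasurable (fun ω => g ω + (I (Ψ n) ω - I (Φ n) ω)) P :=
      hg2.1.add ((hImem _).1.sub (hImem _).1)
    have hm2 : AEStronglyMeasurable (fun ω => I (Φ n) ω - ⟪e k, Y ω⟫) P := (hImem _).1.sub (hYm hY)
    have hm3 : AEStronglyMeasurable (fun ω => I (Ψ n) ω - ⟪e k, Y' ω⟫) P :=
      (hImem _).1.sub (hYm hY')
    rw [h1]
    refine (eLpNorm_sub_le (hm1.add hm2) hm3 (by norm_num)).trans ?_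
    gcongr
    refine (eLpNorm_add_le hm1 hm2 (by norm_num)).trans ?_
    gcongr
    rw [one_div, ENNReal.le_rpow_inv_iff (by norm_num)]
    norm_cast
    rw [hiso]
    gcongr
    exact hJle n
  have hlim : Tendsto (fun n => (eLpNorm g 2 P ^ 2 +
        (eLpNorm (fun s => J (Ψ n) s - expKernel (l k) t' s • R (e k)) 2 volume + δ +
        eLpNorm (fun s => J (Φ n) s - expKernel (l k) t s • R (e k)) 2 volume) ^ 2) ^ (1 / 2 : ℝ) +
      eLpNorm (fun ω => I (Φ n) ω - ⟪e k, Y ω⟫) 2 P +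
      eLpNorm (fun ω => I (Ψ n) ω - ⟪e k, Y' ω⟫) 2 P) atTop
      (𝓝 ((eLpNorm g 2 P ^ 2 + (0 + δ + 0) ^ 2) ^ (1 / 2 : ℝ) + 0 + 0)) := by
    refine Tendsto.add (Tendsto.add ?_ hΦ2) hΨ2
    refine (ENNReal.continuous_rpow_const.tendsto _).comp (tendsto_const_nhds.add ?_)
    exact ((ENNReal.continuous_pow 2).tendsto _).comp ((hΨ1.add tendsto_const_nhds).add hΦ1)
  have hfin := ge_of_tendsto' hlim hmain
  rw [add_zero, add_zero, zero_add, add_zero, one_div, ENNReal.le_rpow_inv_iff (by norm_num)] at hfin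
  norm_cast at hfin
  exact hfin.trans (by gcongr)

end WienerIntegral

end RealizedCovariation

namespace RealizedCovariation

/-! ### Moments of increments, the expected realized covariation, and norm bounds -/

section MildSolution

variable {H : Type*} [NormedAddCommGroup H] [InnerProductSpace ℝ H] [CompleteSpace H]
variable {Ω : Type*} {mΩ : MeasurableSpace Ω} {P : Measure Ω} [IsProbabilityMeasure P]
variable {W X : ℝ≥0 → Ω → H} {X₀ : Ω → H} {A : H →ₗ.[ℝ] H} {Q : H →L[ℝ] H}
variable {ℱ : Filtration ℝ≥0 mΩ} {ι : ℝ}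

lemma IsMildSolution.memLp (hX : IsMildSolution A Q W X₀ X P) (h₀ : MemLp X₀ 4 P) (t : ℝ≥0) :
    MemLp (X t) 2 P := by
  obtain ⟨S, -, hS⟩ := hX
  obtain ⟨Y, hY, hXY⟩ := hS t
  have h1 : MemLp (fun ω => S t (X₀ ω)) 2 P :=
    (S t).comp_memLp' (h₀.mono_exponent (by norm_num))
  exact (memLp_congr_ae hXY).2 (h1.add hY.1)

/-- The increment of the coordinate is a multiple of the `ℱ 0`-measurable `⟪e k, X₀⟫` plus a
difference of stochastic convolutions; the two are orthogonal. -/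
lemma IsMildSolution.integral_inner_sub_sq_le {e : HilbertBasis ℕ ℝ H} {l : ℕ → ℝ}
    (hW : IsQWiener W Q ℱ P) (hX : IsMildSolution (diagOp e l) Q W X₀ X P)
    (h₀ : InitialAssumption A X₀ ι ℱ P) {t t' : ℝ≥0} (htt' : t ≤ t') {k : ℕ} (hl : 0 < l k)
    (hQk : 0 ≤ ⟪Q (e k), e k⟫) :
    ∫ ω, ⟪e k, X t' ω - X t ω⟫ ^ 2 ∂P ≤
      (Real.exp (-(l k * t')) - Real.exp (-(l k * t))) ^ 2 * ∫ ω, ⟪e k, X₀ ω⟫ ^ 2 ∂P +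
      ⟪Q (e k), e k⟫ * ((1 - Real.exp (-(l k * (t' - t)))) / l k) := by
  have hmem : MemLp (fun ω => ⟪e k, X t' ω - X t ω⟫) 2 P :=
    ((hX.memLp h₀.memLp t').sub (hX.memLp h₀.memLp t)).const_inner _
  obtain ⟨S, hS, hXS⟩ := hX
  obtain ⟨Y, hY, hXY⟩ := hXS t
  obtain ⟨Y', hY', hXY'⟩ := hXS t'
  set c := Real.exp (-(l k * t')) - Real.exp (-(l k * t)) with hc
  have hx2 : MemLp (fun ω => ⟪e k, X₀ ω⟫) 2 P :=
    (h₀.memLp.mono_exponent (by norm_num)).const_inner _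
  have hg : StronglyMeasurable[ℱ 0] fun ω => c * ⟪e k, X₀ ω⟫ :=
    (stronglyMeasurable_const.inner h₀.stronglyMeasurable).const_mul c
  have hg2 : MemLp (fun ω => c * ⟪e k, X₀ ω⟫) 2 P := hx2.const_mul c
  have h := eLpNorm_add_inner_sub_inner_sq_le hW hS htt' hY hY' hl hg hg2
  have hae : (fun ω => c * ⟪e k, X₀ ω⟫ + (⟪e k, Y' ω⟫ - ⟪e k, Y ω⟫)) =ᵐ[P]
      fun ω => ⟪e k, X t' ω - X t ω⟫ := by
    filter_upwards [hXY, hXY'] with ω h1 h2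
    rw [h1, h2, inner_sub_right, inner_add_right, inner_add_right,
      hS.inner_basis_apply k (NNReal.coe_nonneg t), hS.inner_basis_apply k (NNReal.coe_nonneg t'), hc]
    ring
  have hpos : 0 ≤ ⟪Q (e k), e k⟫ * ((1 - Real.exp (-(l k * (t' - t)))) / l k) := by
    have : Real.exp (-(l k * (t' - t))) ≤ 1 := by
      rw [Real.exp_le_one_iff]
      have := mul_nonneg hl.le (sub_nonneg.2 (NNReal.coe_le_coe.2 htt'))
      linarith
    exact mul_nonneg hQk (div_nonneg (by linarith) hl.le)
  rw [eLpNorm_congr_ae hae, eLpNorm_two_sq_eq_ofReal hmem, eLpNorm_two_sq_eq_ofReal hg2,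
    ← ENNReal.ofReal_add (integral_nonneg fun _ => sq_nonneg _) hpos,
    ENNReal.ofReal_le_ofReal_iff (add_nonneg (integral_nonneg fun _ => sq_nonneg _) hpos)] at h
  simp only [Real.norm_eq_abs, sq_abs, mul_pow] at h
  rwa [integral_const_mul] at h

lemma MemLp.integrable_rankOne_self {x : Ω → H} (hx : MemLp x 2 P) :
    Integrable (fun ω => InnerProductSpace.rankOne ℝ (x ω) (x ω)) P := by
  have hc : Continuous fun v : H => (InnerProductSpace.rankOne ℝ v v : H →L[ℝ] H) :=
    (InnerProductSpace.rankOne ℝ : H →L[ℝ] H →L⋆[ℝ] H →L[ℝ] H).continuous₂.comp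
      (continuous_id.prodMk continuous_id)
  refine (integrable_norm_iff (hc.comp_aestronglyMeasurable hx.1)).1 ?_
  simp only [InnerProductSpace.norm_rankOne, ← sq]
  exact hx.integrable_norm_pow two_ne_zero

lemma IsMildSolution.integrable_realizedCovariation (hX : IsMildSolution A Q W X₀ X P)
    (h₀ : MemLp X₀ 4 P) (T Δ : ℝ≥0) : Integrable (realizedCovariation X T Δ) P := by
  have h : ∀ i : ℕ, Integrable (fun ω => (InnerProductSpace.rankOne ℝ
      (X ((i + 1) * Δ) ω - X (i * Δ) ω) (X ((i + 1) * Δ) ω - X (i * Δ) ω) : H →L[ℝ] H)) P := by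
    intro i
    have h : MemLp (fun ω => X ((i + 1) * Δ) ω - X (i * Δ) ω) 2 P :=
      (hX.memLp h₀ _).sub (hX.memLp h₀ _)
    exact MemLp.integrable_rankOne_self h
  exact integrable_finsetSum (Finset.range ⌊T / Δ⌋₊)
    (f := fun (i : ℕ) ω => (InnerProductSpace.rankOne ℝ
      (X ((i + 1) * Δ) ω - X (i * Δ) ω) (X ((i + 1) * Δ) ω - X (i * Δ) ω) : H →L[ℝ] H))
    fun i _ => h i

lemma inner_integral_realizedCovariation (hX : IsMildSolution A Q W X₀ X P)
    (h₀ : MemLp X₀ 4 P) (T Δ : ℝ≥0) (v : H) :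
    ⟪v, (∫ ω, (T : ℝ)⁻¹ • realizedCovariation X T Δ ω ∂P) v⟫ =
      (T : ℝ)⁻¹ * ∑ i ∈ Finset.range ⌊T / Δ⌋₊,
        ∫ ω, ⟪v, X ((i + 1) * Δ) ω - X (i * Δ) ω⟫ ^ 2 ∂P := by
  have hint : ∀ s t, Integrable (fun ω => ⟪v, X s ω - X t ω⟫ ^ 2) P := fun s t =>
    (((hX.memLp h₀ s).sub (hX.memLp h₀ t)).const_inner v).integrable_sq
  rw [integral_smul, _root_.smul_apply, inner_smul_right,
    ContinuousLinearMap.integral_apply (hX.integrable_realizedCovariation h₀ T Δ),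
    ← integral_inner ((hX.integrable_realizedCovariation h₀ T Δ).apply_continuousLinearMap v),
    ← integral_finsetSum _ fun i _ => hint _ _]
  congr 1
  refine integral_congr_ae (Eventually.of_forall fun ω => ?_)
  simp only [realizedCovariation, _root_.sum_apply, inner_sum, InnerProductSpace.rankOne_apply,
    inner_smul_right]
  refine Finset.sum_congr rfl fun i _ => ?_
  rw [real_inner_comm, sq]

/-- Each difference has absolute value at most 1, so its square is at most that absolute value, and
these telescope. The initial value thus contributes a bounded amount however many steps there are.
-/
lemma sum_exp_sub_exp_sq_le {x : ℝ} (hx : 0 ≤ x) (N : ℕ) :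
    ∑ i ∈ Finset.range N, (Real.exp (-(x * (i + 1))) - Real.exp (-(x * i))) ^ 2 ≤ 1 := by
  have h : ∀ i : ℕ, (Real.exp (-(x * (i + 1))) - Real.exp (-(x * i))) ^ 2 ≤
      -Real.exp (-(x * ((i + 1 : ℕ) : ℝ))) - -Real.exp (-(x * (i : ℝ))) := by
    intro i
    push_cast
    have h1 : Real.exp (-(x * (i + 1))) ≤ Real.exp (-(x * i)) := Real.exp_le_exp.2 (by linarith)
    have h2 : Real.exp (-(x * i)) ≤ 1 := by
      rw [Real.exp_le_one_iff]
      have : 0 ≤ x * i := by positivity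
      linarith
    have h3 : 0 < Real.exp (-(x * (i + 1))) := Real.exp_pos _
    nlinarith
  refine (Finset.sum_le_sum fun i _ => h i).trans ?_
  rw [Finset.sum_range_sub (fun i : ℕ => -Real.exp (-(x * (i : ℝ))))]
  have := Real.exp_pos (-(x * N))
  simp
  linarith

/-- Each step contributes at most `μ / λ` of noise, and there are at most `T / Δ` steps. The bound
is useful when `l k * Δ` is large. -/
lemma inner_integral_realizedCovariation_le {e : HilbertBasis ℕ ℝ H} {l : ℕ → ℝ}
    (hW : IsQWiener W Q ℱ P) (hX : IsMildSolution (diagOp e l) Q W X₀ X P)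
    (h₀ : InitialAssumption A X₀ ι ℱ P) {T Δ : ℝ≥0} (hT : 0 < T) (hΔ : 0 < Δ) {k : ℕ}
    (hl : 0 < l k) (hQk : 0 ≤ ⟪Q (e k), e k⟫) :
    ⟪e k, (∫ ω, (T : ℝ)⁻¹ • realizedCovariation X T Δ ω ∂P) (e k)⟫ ≤
      (T : ℝ)⁻¹ * ∫ ω, ⟪e k, X₀ ω⟫ ^ 2 ∂P + ⟪Q (e k), e k⟫ * (1 / (l k * Δ)) := by
  have hT' : (0 : ℝ) < T := hT
  have hΔ' : (0 : ℝ) < Δ := hΔ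
  set m := ∫ ω, ⟪e k, X₀ ω⟫ ^ 2 ∂P with hm
  have hm0 : 0 ≤ m := integral_nonneg fun _ => sq_nonneg _
  set N := ⌊T / Δ⌋₊ with hN
  have hNT : (N : ℝ) * Δ ≤ T := by
    have h1 : (N : ℝ≥0) ≤ T / Δ := Nat.floor_le zero_le
    have h2 : (N : ℝ) ≤ T / Δ := by exact_mod_cast h1
    exact (le_div_iff₀ hΔ').1 h2
  rw [inner_integral_realizedCovariation hX h₀.memLp]
  have hterm : ∀ i ∈ Finset.range N, ∫ ω, ⟪e k, X ((i + 1) * Δ) ω - X (i * Δ) ω⟫ ^ 2 ∂P ≤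
      (Real.exp (-(l k * Δ * (i + 1))) - Real.exp (-(l k * Δ * i))) ^ 2 * m +
        ⟪Q (e k), e k⟫ * (1 / l k) := by
    intro i _
    have hle : (i : ℝ≥0) * Δ ≤ (i + 1) * Δ := by gcongr; simp
    refine (hX.integral_inner_sub_sq_le hW h₀ hle hl hQk).trans ?_
    push_cast
    rw [show l k * ((i + 1 : ℝ) * Δ) = l k * Δ * (i + 1) by ring,
      show l k * ((i : ℝ) * Δ) = l k * Δ * i by ring]
    gcongr
    have := Real.exp_pos (-(l k * ((i + 1 : ℝ) * Δ - i * Δ)))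
    linarith
  calc (T : ℝ)⁻¹ * ∑ i ∈ Finset.range N, ∫ ω, ⟪e k, X ((i + 1) * Δ) ω - X (i * Δ) ω⟫ ^ 2 ∂P
      ≤ (T : ℝ)⁻¹ * (1 * m + N * (⟪Q (e k), e k⟫ * (1 / l k))) := by
        gcongr
        refine (Finset.sum_le_sum hterm).trans ?_
        rw [Finset.sum_add_distrib, ← Finset.sum_mul, Finset.sum_const, Finset.card_range,
          nsmul_eq_mul]
        gcongr
        exact sum_exp_sub_exp_sq_le (by positivity) N
    _ ≤ (T : ℝ)⁻¹ * (1 * m + T / Δ * (⟪Q (e k), e k⟫ * (1 / l k))) := by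
        gcongr
        rwa [le_div_iff₀ hΔ']
    _ = _ := by
        field_simp

/-- Jensen's inequality for the Hilbert-Schmidt norm. -/
lemma hsNorm_integral_le_hsL2Norm (e : HilbertBasis ℕ ℝ H) {Z : Ω → H →L[ℝ] H}
    (hZ : Integrable Z P) : hsNorm (∫ ω, Z ω ∂P) ≤ hsL2Norm Z P := by
  rw [hsL2Norm, one_div, ENNReal.le_rpow_inv_iff (by norm_num)]
  norm_cast
  rw [hsNorm_sq e]
  simp_rw [hsNorm_sq e]
  have hm : ∀ j, AEStronglyMeasurable (fun ω => Z ω (e j)) P := fun j =>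
    (hZ.apply_continuousLinearMap (e j)).1
  rw [lintegral_tsum fun j => ((hm j).enorm.pow_const 2)]
  refine ENNReal.tsum_le_tsum fun j => ?_
  rw [ContinuousLinearMap.integral_apply hZ, ← eLpNorm_two_sq]
  gcongr
  refine (enorm_integral_le_lintegral_enorm _).trans ?_
  rw [← eLpNorm_one_eq_lintegral_enorm]
  exact eLpNorm_le_eLpNorm_of_exponent_le (by norm_num) (hm j)

lemma hsNorm_integral_sub_le_hsL2Norm (e : HilbertBasis ℕ ℝ H) {Z : Ω → H →L[ℝ] H}
    (hZ : Integrable Z P) (B : H →L[ℝ] H) :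
    hsNorm ((∫ ω, Z ω ∂P) - B) ≤ hsL2Norm (fun ω => Z ω - B) P := by
  have h : ∫ ω, (Z ω - B) ∂P = (∫ ω, Z ω ∂P) - B := by
    rw [integral_sub hZ (integrable_const B), integral_const, probReal_univ, one_smul]
  rw [← h]
  exact hsNorm_integral_le_hsL2Norm e (hZ.sub (integrable_const B))

lemma IsMildSolution.hsNorm_bias_le (e : HilbertBasis ℕ ℝ H) (hX : IsMildSolution A Q W X₀ X P)
    (h₀ : MemLp X₀ 4 P) (T Δ : ℝ≥0) :
    hsNorm ((∫ ω, (T : ℝ)⁻¹ • realizedCovariation X T Δ ω ∂P) - Q) ≤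
      hsL2Norm (fun ω => (T : ℝ)⁻¹ • realizedCovariation X T Δ ω - Q) P :=
  hsNorm_integral_sub_le_hsL2Norm e
    (Z := fun ω => (T : ℝ)⁻¹ • realizedCovariation X T Δ ω)
    ((hX.integrable_realizedCovariation h₀ T Δ).smul (T : ℝ)⁻¹) Q

/-- Cauchy–Schwarz over `s`. The diagonal entries enter linearly, which suits the initial-value
terms: only weighted sums of them are controlled. -/
lemma ofReal_sum_inner_div_sqrt_card_le_hsNorm (e : HilbertBasis ℕ ℝ H) (B : H →L[ℝ] H)
    (s : Finset ℕ) :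
    ENNReal.ofReal ((∑ k ∈ s, ⟪e k, B (e k)⟫) / √(s.card)) ≤ hsNorm B := by
  rcases s.eq_empty_or_nonempty with rfl | hs
  · simp
  have hcard : (0 : ℝ) < s.card := by exact_mod_cast hs.card_pos
  rw [← ENNReal.pow_le_pow_left_iff two_ne_zero, hsNorm_sq e]
  refine le_trans ?_ (ENNReal.sum_le_tsum s)
  have h1 : ∑ k ∈ s, ‖B (e k)‖ₑ ^ 2 = ENNReal.ofReal (∑ k ∈ s, ‖B (e k)‖ ^ 2) := by
    rw [ENNReal.ofReal_sum_of_nonneg fun _ _ => sq_nonneg _]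
    exact Finset.sum_congr rfl fun k _ => by
      rw [ENNReal.ofReal_pow (norm_nonneg _), ofReal_norm]
  rw [h1]
  rcases le_or_gt ((∑ k ∈ s, ⟪e k, B (e k)⟫) / √(s.card)) 0 with h | h
  · rw [ENNReal.ofReal_of_nonpos h]
    simp
  rw [← ENNReal.ofReal_pow h.le]
  apply ENNReal.ofReal_le_ofReal
  rw [div_pow, Real.sq_sqrt hcard.le, div_le_iff₀ hcard, mul_comm]
  refine sq_sum_le_card_mul_sum_sq.trans ?_
  refine mul_le_mul_of_nonneg_left (Finset.sum_le_sum fun k _ => sq_le_sq.2 ?_) hcard.le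
  rw [abs_norm]
  refine (abs_real_inner_le_norm _ _).trans ?_
  rw [e.orthonormal.1 k, one_mul]

lemma ofReal_sum_weighted_sq_le_normPow_sq {e : HilbertBasis ℕ ℝ H} {l : ℕ → ℝ} (hl : ∀ j, 1 ≤ l j)
    {r q : ℝ} (hrq : r ≤ 2 * q) (v : H) (s : Finset ℕ) :
    ENNReal.ofReal (∑ j ∈ s, l j ^ r * ⟪e j, v⟫ ^ 2) ≤ normPow (diagOp e l) q v ^ 2 := by
  have hl0 : ∀ j, 0 < l j := fun j => one_pos.trans_le (hl j)
  rw [normPow]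
  split_ifs with hv
  · have hin : ∀ j, ⟪e j, fracPow (diagOp e l) q ⟨v, hv⟩⟫ = l j ^ q * ⟪e j, v⟫ := by
      have hg : (v, fracPow (diagOp e l) q ⟨v, hv⟩) ∈ (fracPow (diagOp e l) q).graph :=
        LinearPMap.mem_graph _ ⟨v, hv⟩
      generalize fracPow (diagOp e l) q ⟨v, hv⟩ = w at hg ⊢
      rwa [fracPow_diagOp e l hl0 q, mem_graph_diagOp] at hg
    rw [← tsum_enorm_inner_sq e]
    refine le_trans ?_ (ENNReal.sum_le_tsum s)
    rw [ENNReal.ofReal_sum_of_nonneg fun j _ =>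
      mul_nonneg (Real.rpow_nonneg (hl0 j).le _) (sq_nonneg _)]
    gcongr with j _
    rw [hin, ← ofReal_norm, ← ENNReal.ofReal_pow (norm_nonneg _), Real.norm_eq_abs, sq_abs, mul_pow,
      ← Real.rpow_natCast (l j ^ q), ← Real.rpow_mul (hl0 j).le]
    apply ENNReal.ofReal_le_ofReal
    gcongr
    · exact hl j
    · push_cast
      linarith
  · simp

lemma InitialAssumption.exists_sum_weighted_le {e : HilbertBasis ℕ ℝ H} {l : ℕ → ℝ}
    (h₀ : InitialAssumption (diagOp e l) X₀ ι ℱ P) (hl : ∀ j, 1 ≤ l j) {r : ℝ} (hr : r ≤ ι) :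
    ∃ M : ℝ, ∀ s : Finset ℕ, ∑ j ∈ s, l j ^ r * ∫ ω, ⟪e j, X₀ ω⟫ ^ 2 ∂P ≤ M := by
  have hint : ∀ j, Integrable (fun ω => ⟪e j, X₀ ω⟫ ^ 2) P := fun j =>
    ((h₀.memLp.mono_exponent (by norm_num : (2 : ℝ≥0∞) ≤ 4)).const_inner _).integrable_sq
  -- From `x² ≤ 1 + x⁴` and total mass one.
  refine ⟨(1 + ∫⁻ ω, normPow (diagOp e l) (ι / 2) (X₀ ω) ^ 4 ∂P).toReal, fun s => ?_⟩
  have hfin : 1 + ∫⁻ ω, normPow (diagOp e l) (ι / 2) (X₀ ω) ^ 4 ∂P ≠ ∞ :=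
    ENNReal.add_ne_top.2 ⟨ENNReal.one_ne_top, h₀.regularity.ne⟩
  refine (ENNReal.ofReal_le_iff_le_toReal hfin).1 ?_
  simp_rw [← integral_const_mul]
  rw [← integral_finsetSum _ fun j _ => (hint j).const_mul _, ofReal_integral_eq_lintegral_ofReal]
  · calc _ ≤ ∫⁻ ω, (1 + normPow (diagOp e l) (ι / 2) (X₀ ω) ^ 4) ∂P := by
          refine lintegral_mono fun ω => ?_
          refine (ofReal_sum_weighted_sq_le_normPow_sq hl (q := ι / 2) (by linarith) _ s).trans ?_
          rcases le_total (normPow (diagOp e l) (ι / 2) (X₀ ω)) 1 with h | h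
          · exact le_add_right (pow_le_one₀ zero_le h)
          · exact le_add_left (pow_le_pow_right₀ h (by norm_num))
      _ = _ := by
          rw [lintegral_add_left measurable_const]
          simp
  · exact integrable_finsetSum _ fun j _ => (hint j).const_mul _
  · exact Eventually.of_forall fun ω => Finset.sum_nonneg fun j _ =>
      mul_nonneg (Real.rpow_nonneg (zero_le_one.trans (hl j)) _) (sq_nonneg _)

end MildSolution

end RealizedCovariation

namespace RealizedCovariation

/-! ### Choice of the window of modes -/

section Asymptotics

/-- Quantitative form of the lower bound for the tail sums over the window `K ≤ j < 2K` with
`K` of order `Δ ^ (-1/2)`. -/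
lemma exists_window_lower_bound {γ : ℝ} (hγ : γ ∈ Set.Ioo (1 / 2 : ℝ) 1) (M : ℝ) :
    ∃ Δ₀ : ℝ, 0 < Δ₀ ∧ ∀ Δ : ℝ, 0 < Δ → Δ < Δ₀ → ∃ K : ℕ, 1 ≤ K ∧ 2 ≤ (K : ℝ) ^ 2 * Δ ∧
      1 / 48 * (Δ ^ (γ / 2) / |Real.log Δ|) ≤
        (K * (1 / 2 * (1 / ((2 * K : ℝ) ^ (γ + 1 / 2) * Real.log (2 * K)))) -
          M * (K : ℝ) ^ (-γ)) / √K := by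
  obtain ⟨hγ1, hγ2⟩ := hγ
  -- Beyond the resulting threshold, `16 M log (2x) ≤ √x`: the initial-value term is at most half of
  -- the main term.
  have hlim : Tendsto (fun x : ℝ => 16 * M * Real.log (2 * x) / x ^ (1 / 2 : ℝ)) atTop (𝓝 0) := by
    have h1 := ((isLittleO_log_rpow_atTop (by norm_num : (0 : ℝ) < 1 / 2)).tendsto_div_nhds_zero.comp
      (tendsto_id.const_mul_atTop (by norm_num : (0 : ℝ) < 2))).const_mul (16 * M * 2 ^ (1 / 2 : ℝ))
    rw [mul_zero] at h1
    refine h1.congr' ?_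
    filter_upwards [eventually_gt_atTop 0] with x hx
    simp only [Function.comp, id]
    rw [Real.mul_rpow (by norm_num) hx.le]
    field_simp
  obtain ⟨x₀, hx₀⟩ := eventually_atTop.1 (hlim.eventually_le_const (by norm_num : (0 : ℝ) < 1))
  set x₁ := max x₀ 1 with hx₁
  have hx1 : 1 ≤ x₁ := le_max_right _ _
  -- `1 / 36` gives `log 6 ≤ |log Δ| / 2`, so `log (6 y) ≤ |log Δ|` for `y = Δ ^ (-1/2)`; the other
  -- bound gives `x₁ ≤ y`.
  refine ⟨min (1 / 36) (x₁ ^ 2)⁻¹, by positivity, fun Δ hΔ hΔlt => ?_⟩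
  have hΔ1 : Δ < 1 / 36 := hΔlt.trans_le (min_le_left _ _)
  have hΔ2 : Δ < (x₁ ^ 2)⁻¹ := hΔlt.trans_le (min_le_right _ _)
  set y := Δ ^ (-(1 / 2) : ℝ) with hy
  have hy0 : 0 < y := Real.rpow_pos_of_pos hΔ _
  have hy2 : y ^ 2 * Δ = 1 := by
    rw [hy, ← Real.rpow_natCast, ← Real.rpow_mul hΔ.le]
    norm_num
    rw [Real.rpow_neg_one, inv_mul_cancel₀ hΔ.ne']
  have hyx : x₁ ≤ y := by
    have h1 : x₁ ^ 2 ≤ y ^ 2 := by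
      have h2 : x₁ ^ 2 * Δ ≤ 1 := by
        have := mul_le_mul_of_nonneg_left hΔ2.le (sq_nonneg x₁)
        rwa [mul_inv_cancel₀ (by positivity)] at this
      rw [← hy2] at h2
      exact le_of_mul_le_mul_right h2 hΔ
    exact (sq_le_sq₀ (by linarith) hy0.le).1 h1
  -- Since `y ≥ 1`, this places `K` in `[2y, 3y]`, whence `K² Δ ≥ 4`.
  set K := ⌈2 * y⌉₊ with hK
  have hK1 : 2 * y ≤ K := Nat.le_ceil _
  have hK2 : (K : ℝ) ≤ 3 * y := by
    have := (Nat.ceil_lt_add_one (by positivity : 0 ≤ 2 * y)).le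
    linarith
  have hKpos : (0 : ℝ) < K := by linarith
  have hKone : (1 : ℝ) ≤ K := by linarith
  refine ⟨K, by exact_mod_cast hKone, by nlinarith, ?_⟩
  set L := Real.log (2 * K) with hL
  have hLpos : 0 < L := Real.log_pos (by linarith)
  -- the logarithm of the window is controlled by `|log Δ|`
  have hlogΔ : Real.log Δ < -(2 * Real.log 6) := by
    have h1 := Real.log_lt_log hΔ hΔ1
    rw [show (1 / 36 : ℝ) = (6 ^ 2)⁻¹ by norm_num, Real.log_inv, Real.log_pow] at h1
    push_cast at h1
    exact h1
  have hlog6 : 0 < Real.log 6 := Real.log_pos (by norm_num)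
  have hLle : L ≤ |Real.log Δ| := by
    have h1 : L ≤ Real.log (6 * y) := Real.log_le_log (by linarith) (by linarith)
    rw [Real.log_mul (by norm_num) hy0.ne', hy, Real.log_rpow hΔ] at h1
    rw [abs_of_neg (by linarith)]
    linarith
  have hMbound : M * (K : ℝ) ^ (-γ) ≤ (K : ℝ) ^ (1 / 2 - γ) / (16 * L) := by
    have h1 := hx₀ K ((le_max_left _ _).trans (hyx.trans (by linarith)))
    rw [div_le_one (Real.rpow_pos_of_pos hKpos _)] at h1
    rw [le_div_iff₀ (by positivity), sub_eq_add_neg, Real.rpow_add hKpos]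
    have h2 := Real.rpow_pos_of_pos hKpos (-γ)
    nlinarith
  have h8 : (2 : ℝ) ^ (γ + 1 / 2) ≤ 4 := by
    calc (2 : ℝ) ^ (γ + 1 / 2) ≤ 2 ^ (2 : ℝ) :=
          Real.rpow_le_rpow_of_exponent_le (by norm_num) (by linarith)
      _ = 4 := by norm_num
  have hmain : (K : ℝ) ^ (1 / 2 - γ) / (8 * L) ≤
      K * (1 / 2 * (1 / ((2 * K : ℝ) ^ (γ + 1 / 2) * L))) := by
    have h1 : K * (1 / 2 * (1 / ((2 * K : ℝ) ^ (γ + 1 / 2) * L))) =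
        (K : ℝ) ^ (1 / 2 - γ) / (2 * 2 ^ (γ + 1 / 2) * L) := by
      rw [Real.mul_rpow (by norm_num) hKpos.le,
        show (1 / 2 - γ : ℝ) = 1 - (γ + 1 / 2) by ring, Real.rpow_sub hKpos, Real.rpow_one]
      field_simp
    rw [h1]
    gcongr
    linarith
  have hsqrt : (K : ℝ) ^ (1 / 2 - γ) = √K * (K : ℝ) ^ (-γ) := by
    rw [sub_eq_add_neg, Real.rpow_add hKpos, Real.sqrt_eq_rpow]
  have hKγ : Δ ^ (γ / 2) / 3 ≤ (K : ℝ) ^ (-γ) := by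
    calc Δ ^ (γ / 2) / 3 ≤ 3 ^ (-γ) * Δ ^ (γ / 2) := by
          have h3 : (3 : ℝ) ^ (-1 : ℝ) ≤ 3 ^ (-γ) :=
            Real.rpow_le_rpow_of_exponent_le (by norm_num) (by linarith)
          rw [Real.rpow_neg_one] at h3
          have := Real.rpow_pos_of_pos hΔ (γ / 2)
          rw [div_eq_inv_mul]
          gcongr
      _ = (3 * y) ^ (-γ) := by
          rw [Real.mul_rpow (by norm_num) hy0.le, hy, ← Real.rpow_mul hΔ.le]
          congr 2
          ring
      _ ≤ (K : ℝ) ^ (-γ) := Real.rpow_le_rpow_of_nonpos hKpos hK2 (by linarith)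
  -- The main term minus the initial one is at least `1/8 - 1/16 = 1/16` of `K ^ (1/2 - γ) / L`, and
  -- `K ^ (-γ)` costs a factor 3: hence `1 / 48`.
  rw [le_div_iff₀ (Real.sqrt_pos.2 hKpos)]
  calc 1 / 48 * (Δ ^ (γ / 2) / |Real.log Δ|) * √K
      ≤ 1 / 48 * (Δ ^ (γ / 2) / L) * √K := by
        have := Real.rpow_pos_of_pos hΔ (γ / 2)
        gcongr
    _ = Δ ^ (γ / 2) / 3 * √K / (16 * L) := by
        field_simp
        norm_num
    _ ≤ (K : ℝ) ^ (-γ) * √K / (16 * L) := by gcongr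
    _ = (K : ℝ) ^ (1 / 2 - γ) / (8 * L) - (K : ℝ) ^ (1 / 2 - γ) / (16 * L) := by
        rw [hsqrt]
        field_simp
        norm_num
    _ ≤ _ := sub_le_sub hmain hMbound

lemma noiseEigenvalue_ge {γ : ℝ} (hγ : 0 ≤ γ) {K j : ℕ} (hK : 1 ≤ K) (hj : j ∈ Finset.Ico K (2 * K)) :
    1 / ((2 * K : ℝ) ^ (γ + 1 / 2) * Real.log (2 * K)) ≤ noiseEigenvalue γ j := by
  rw [Finset.mem_Ico] at hj
  have h1 : (1 : ℝ) ≤ j := by exact_mod_cast hK.trans hj.1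
  have h2 : (j : ℝ) + 1 ≤ 2 * K := by exact_mod_cast hj.2
  have h3 : 0 < Real.log ((j : ℝ) + 1) := Real.log_pos (by linarith)
  rw [noiseEigenvalue, if_neg (by omega)]
  gcongr

end Asymptotics

/-! ### Lower bound for the bias -/

section LowerBound

variable {H : Type*} [NormedAddCommGroup H] [InnerProductSpace ℝ H] [CompleteSpace H]
variable {Ω : Type*} {mΩ : MeasurableSpace Ω} {P : Measure Ω} [IsProbabilityMeasure P]
variable {W X : ℝ≥0 → Ω → H} {X₀ : Ω → H} {Q : H →L[ℝ] H}
variable {ℱ : Filtration ℝ≥0 mΩ} {ι : ℝ}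

lemma exists_hsNorm_bias_lower_bound {e : HilbertBasis ℕ ℝ H} {γ : ℝ}
    (hγ : γ ∈ Set.Ioo (1 / 2 : ℝ) 1) {T : ℝ≥0} (hT : 0 < T)
    (hQ : ∀ j, Q (e j) = noiseEigenvalue γ j • e j) (hW : IsQWiener W Q ℱ P) (hι : γ / 2 ≤ ι)
    (h₀ : InitialAssumption (diagOp e fun j => ((j : ℝ) + 1) ^ 2) X₀ ι ℱ P)
    (hX : IsMildSolution (diagOp e fun j => ((j : ℝ) + 1) ^ 2) Q W X₀ X P) :
    ∃ Δ₀ : ℝ≥0, 0 < Δ₀ ∧ ∀ Δ : ℝ≥0, 0 < Δ → Δ < Δ₀ →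
      ENNReal.ofReal (1 / 48 * ((Δ : ℝ) ^ (γ / 2) / |Real.log Δ|)) ≤
        hsNorm ((∫ ω, (T : ℝ)⁻¹ • realizedCovariation X T Δ ω ∂P) - Q) := by
  have hγ0 : 0 ≤ γ := by linarith [hγ.1]
  obtain ⟨M, hMs⟩ := h₀.exists_sum_weighted_le (fun j => by
    have : (0 : ℝ) ≤ j := Nat.cast_nonneg j
    nlinarith) hι
  obtain ⟨Δ₀, hΔ₀, hwin⟩ := exists_window_lower_bound hγ ((T : ℝ)⁻¹ * M)
  refine ⟨⟨Δ₀, hΔ₀.le⟩, hΔ₀, fun Δ hΔ hΔlt => ?_⟩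
  obtain ⟨K, hK, hKΔ, hlow⟩ := hwin Δ hΔ hΔlt
  have hKpos : (0 : ℝ) < K := by exact_mod_cast hK
  set B := ∫ ω, (T : ℝ)⁻¹ • realizedCovariation X T Δ ω ∂P with hB
  set m : ℕ → ℝ := fun j => ∫ ω, ⟪e j, X₀ ω⟫ ^ 2 ∂P with hm
  have hm0 : ∀ j, 0 ≤ m j := fun j => integral_nonneg fun _ => sq_nonneg _
  have hQin : ∀ j, ⟪Q (e j), e j⟫ = noiseEigenvalue γ j := fun j => by
    rw [hQ, real_inner_smul_left, real_inner_self_eq_norm_sq, e.orthonormal.1 j]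
    simp
  -- On the window `λ_j Δ ≥ K² Δ ≥ 2`, so at least half of the eigenvalue is missed.
  have hterm : ∀ j ∈ Finset.Ico K (2 * K),
      1 / 2 * (1 / ((2 * K : ℝ) ^ (γ + 1 / 2) * Real.log (2 * K))) - (T : ℝ)⁻¹ * m j ≤
        ⟪e j, (Q - B) (e j)⟫ := by
    intro j hj
    have hjK : (K : ℝ) ≤ j := by exact_mod_cast (Finset.mem_Ico.1 hj).1
    have h1 := inner_integral_realizedCovariation_le hW hX h₀ hT hΔ (k := j) (by positivity)
      (by rw [hQin]; exact noiseEigenvalue_nonneg γ j)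
    rw [hQin] at h1
    have h2 : 1 / (((j : ℝ) + 1) ^ 2 * Δ) ≤ 1 / 2 := by
      have : (K : ℝ) ^ 2 * Δ ≤ ((j : ℝ) + 1) ^ 2 * Δ := by gcongr; linarith
      exact one_div_le_one_div_of_le (by norm_num) (by linarith)
    have h3 := noiseEigenvalue_ge hγ0 hK hj
    have h4 := mul_le_mul_of_nonneg_left h2 (noiseEigenvalue_nonneg γ j)
    rw [_root_.sub_apply, inner_sub_right, real_inner_comm, hQin]
    linarith
  -- The weight `λ_j ^ (γ/2) = (j + 1) ^ γ` is at least `K ^ γ` on the window.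
  have hmsum : ∑ j ∈ Finset.Ico K (2 * K), m j ≤ M * (K : ℝ) ^ (-γ) := by
    have h1 : (K : ℝ) ^ γ * ∑ j ∈ Finset.Ico K (2 * K), m j ≤ M := by
      refine le_trans ?_ (hMs (Finset.Ico K (2 * K)))
      rw [Finset.mul_sum]
      refine Finset.sum_le_sum fun j hj => mul_le_mul_of_nonneg_right ?_ (hm0 j)
      have hjK : (K : ℝ) ≤ j := by exact_mod_cast (Finset.mem_Ico.1 hj).1
      rw [← Real.rpow_natCast, ← Real.rpow_mul (by positivity)]
      push_cast
      rw [mul_div_cancel₀ γ (by norm_num : (2 : ℝ) ≠ 0)]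
      exact Real.rpow_le_rpow hKpos.le (by linarith) hγ0
    rw [Real.rpow_neg hKpos.le, ← div_eq_mul_inv, le_div_iff₀ (Real.rpow_pos_of_pos hKpos _)]
    linarith
  have hneg : hsNorm (B - Q) = hsNorm (Q - B) := by
    rw [← neg_sub Q B]
    simp only [hsNorm, _root_.neg_apply, enorm_neg]
  rw [hneg]
  refine le_trans (ENNReal.ofReal_le_ofReal ?_)
    (ofReal_sum_inner_div_sqrt_card_le_hsNorm e (Q - B) (Finset.Ico K (2 * K)))
  have hcard : (Finset.Ico K (2 * K)).card = K := by
    rw [Nat.card_Ico]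
    omega
  rw [hcard]
  refine hlow.trans ?_
  gcongr
  refine le_trans ?_ (Finset.sum_le_sum hterm)
  rw [Finset.sum_sub_distrib, Finset.sum_const, hcard, nsmul_eq_mul, ← Finset.mul_sum]
  have hT' : (0 : ℝ) ≤ (T : ℝ)⁻¹ := by positivity
  have := mul_le_mul_of_nonneg_left hmsum hT'
  linarith

end LowerBound

/-! ### A basis of `L²(D)` indexed by `ℕ` -/

section Basis

/-- Orthonormal vectors are `√2` apart, so balls of radius `1/2` around them are disjoint. -/
lemma HilbertBasis.countable_index {ι H : Type*} [NormedAddCommGroup H] [InnerProductSpace ℝ H]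
    [TopologicalSpace.SeparableSpace H] (b : HilbertBasis ι ℝ H) : Countable ι := by
  refine Pairwise.countable_of_isOpen_disjoint (s := fun i => Metric.ball (b i) (1 / 2)) ?_
    (fun i => Metric.isOpen_ball) (fun i => Metric.nonempty_ball.2 (by norm_num))
  intro i j hij
  refine Metric.ball_disjoint_ball ?_
  have h : dist (b i) (b j) ^ 2 = 2 := by
    rw [dist_eq_norm, norm_sub_sq_real, b.orthonormal.1, b.orthonormal.1, b.orthonormal.2 hij]
    norm_num
  have h0 : 0 ≤ dist (b i) (b j) := dist_nonneg
  nlinarith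

lemma exists_hilbertBasis_nat {H : Type*} [NormedAddCommGroup H] [InnerProductSpace ℝ H]
    [CompleteSpace H] [TopologicalSpace.SeparableSpace H] (hinf : ¬ FiniteDimensional ℝ H) :
    Nonempty (HilbertBasis ℕ ℝ H) := by
  obtain ⟨w, b, -⟩ := exists_hilbertBasis ℝ H
  have hc : Countable w := HilbertBasis.countable_index b
  have hi : Infinite w := by
    by_contra h
    have hfin : Finite w := not_infinite_iff_finite.1 h
    have := Fintype.ofFinite w
    exact hinf (b.toOrthonormalBasis.toBasis.finiteDimensional_of_finite)
  obtain ⟨φ⟩ := nonempty_equiv_of_countable (α := ℕ) (β := w)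
  refine ⟨HilbertBasis.mk (b.orthonormal.comp φ φ.injective) ?_⟩
  rw [φ.surjective.range_comp b, b.dense_span]

/-- Open shells between the radii `r / (n + 2)` and `r / (n + 1)` inside a ball in `D`; they are
nonempty because `d ≥ 1`. -/
lemma exists_disjoint_open_subsets {d : ℕ} (hd : 1 ≤ d) {D : Set (EuclideanSpace ℝ (Fin d))}
    (hD : IsOpen D) (hDne : D.Nonempty) :
    ∃ U : ℕ → Set (EuclideanSpace ℝ (Fin d)), (∀ n, IsOpen (U n)) ∧ (∀ n, (U n).Nonempty) ∧
      (∀ n, U n ⊆ D) ∧ Pairwise (Function.onFun Disjoint U) ∧ ∀ n, Bornology.IsBounded (U n) := by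
  obtain ⟨x, hx⟩ := hDne
  obtain ⟨r, hr, hball⟩ := Metric.isOpen_iff.1 hD x hx
  have : Nontrivial (EuclideanSpace ℝ (Fin d)) := by
    have : Nonempty (Fin d) := ⟨⟨0, hd⟩⟩
    infer_instance
  let s : ℕ → ℝ := fun n => r / (n + 1)
  have hs : ∀ n, 0 < s n := fun n => by positivity
  have hanti : StrictAnti s := strictAnti_nat_of_succ_lt fun n => by
    simp only [s]
    push_cast
    gcongr
    linarith
  refine ⟨fun n => Metric.ball x (s n) \ Metric.closedBall x (s (n + 1)),
    fun n => Metric.isOpen_ball.sdiff Metric.isClosed_closedBall, fun n => ?_, fun n => ?_, ?_,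
    fun n => Metric.isBounded_ball.subset Set.sdiff_subset⟩
  · obtain ⟨ρ, h1, h2⟩ := exists_between (hanti (Nat.lt_succ_self n))
    obtain ⟨v, hv⟩ := exists_norm_eq (EuclideanSpace ℝ (Fin d)) ((hs _).trans h1).le
    refine ⟨x + v, ?_, ?_⟩
    · simpa [hv] using h2
    · simpa [hv] using h1
  · refine Set.sdiff_subset.trans ((Metric.ball_subset_ball ?_).trans hball)
    simpa [s] using hanti.antitone (Nat.zero_le n)
  · rw [pairwise_disjoint_on]
    intro m n hmn
    rw [Set.disjoint_left]
    intro z hz hz'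
    exact hz.2 (Metric.ball_subset_closedBall
      (Metric.ball_subset_ball (hanti.antitone (Nat.succ_le_of_lt hmn)) hz'.1))

/-- Indicators of disjoint sets of positive finite measure form an infinite orthogonal family. -/
lemma not_finiteDimensional_Lp {d : ℕ} (hd : 1 ≤ d) {D : Set (EuclideanSpace ℝ (Fin d))}
    (hD : IsOpen D) (hDne : D.Nonempty) :
    ¬ FiniteDimensional ℝ (Lp ℝ 2 (volume.restrict D)) := by
  obtain ⟨U, hUo, hUne, hUD, hUd, hUb⟩ := exists_disjoint_open_subsets hd hD hDne
  have hUm : ∀ n, MeasurableSet (U n) := fun n => (hUo n).measurableSet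
  have hμ : ∀ n, volume.restrict D (U n) = volume (U n) := fun n => by
    rw [Measure.restrict_apply (hUm n), Set.inter_eq_left.2 (hUD n)]
  have hfin : ∀ n, volume.restrict D (U n) ≠ ∞ := fun n => by
    rw [hμ]
    exact (hUb n).measure_lt_top.ne
  have hpos : ∀ n, 0 < (volume.restrict D).real (U n) := fun n => by
    refine ENNReal.toReal_pos ?_ (hfin n)
    rw [hμ]
    exact ((hUo n).measure_pos volume (hUne n)).ne'
  have hinner : ∀ m n, ⟪indicatorConstLp 2 (hUm m) (hfin m) (1 : ℝ),
      indicatorConstLp 2 (hUm n) (hfin n) (1 : ℝ)⟫ = (volume.restrict D).real (U m ∩ U n) := by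
    intro m n
    rw [L2.inner_indicatorConstLp_indicatorConstLp (hUm m) (hUm n) (hfin m) (hfin n)]
    simp
  have hlin := linearIndependent_of_ne_zero_of_inner_eq_zero (𝕜 := ℝ)
    (v := fun n => indicatorConstLp 2 (hUm n) (hfin n) (1 : ℝ)) (fun n h => by
      have := hinner n n
      rw [h, inner_zero_left, Set.inter_self] at this
      exact (hpos n).ne this) (fun m n hmn => by
      refine (hinner m n).trans ?_
      rw [(hUd hmn).inter_eq]
      simp)
  intro hfd
  exact not_finite_iff_infinite.2 (inferInstance : Infinite ℕ) hlin.finite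

end Basis

end RealizedCovariation

set_option maxHeartbeats 1000000 in
theorem proposition1
    -- the state space `H = L²(D)`
    (d : ℕ) (hd : 1 ≤ d) (D : Set (EuclideanSpace ℝ (Fin d))) (hD : IsOpen D) (hDne : D.Nonempty)
    (γ : ℝ) (hγ : γ ∈ Set.Ioo (1 / 2 : ℝ) 1) (T : ℝ≥0) (hT : 0 < T) :
    ∃ (A : Lp ℝ 2 (volume.restrict D) →ₗ.[ℝ] Lp ℝ 2 (volume.restrict D))
      (Q : Lp ℝ 2 (volume.restrict D) →L[ℝ] Lp ℝ 2 (volume.restrict D)),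
      -- `A` and `Q` are diagonal with eigenvalues `k²` and `1 / (k^{γ + 1/2} log k)`
      (∃ e : HilbertBasis ℕ ℝ (Lp ℝ 2 (volume.restrict D)),
        A = diagOp e (fun j => ((j : ℝ) + 1) ^ 2) ∧ ∀ j, Q (e j) = noiseEigenvalue γ j • e j) ∧
      OperatorAssumption A Q γ ∧
      ∃ C : ℝ, 0 < C ∧
        ∀ (Ω : Type*) (mΩ : MeasurableSpace Ω) (P : Measure Ω) (_ : IsProbabilityMeasure P)
          (ℱ : Filtration ℝ≥0 mΩ) (W X : ℝ≥0 → Ω → Lp ℝ 2 (volume.restrict D))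
          (X₀ : Ω → Lp ℝ 2 (volume.restrict D)) (ι : ℝ),
          IsQWiener W Q ℱ P → γ / 2 ≤ ι → InitialAssumption A X₀ ι ℱ P →
          IsMildSolution A Q W X₀ X P →
          ∃ Δ₀ : ℝ≥0, 0 < Δ₀ ∧ ∀ Δ : ℝ≥0, 0 < Δ → Δ < Δ₀ →
            Integrable (realizedCovariation X T Δ) P ∧
            hsNorm ((∫ ω, (T : ℝ)⁻¹ • realizedCovariation X T Δ ω ∂P) - Q) ≤
              hsL2Norm (fun ω => (T : ℝ)⁻¹ • realizedCovariation X T Δ ω - Q) P ∧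
            ENNReal.ofReal (C * ((Δ : ℝ) ^ (γ / 2) / |Real.log Δ|)) ≤
              hsNorm ((∫ ω, (T : ℝ)⁻¹ • realizedCovariation X T Δ ω ∂P) - Q) := by
  have : Fact ((2 : ℝ≥0∞) ≠ ∞) := ⟨by norm_num⟩
  obtain ⟨e⟩ := exists_hilbertBasis_nat (not_finiteDimensional_Lp hd hD hDne)
  have hsum := noiseEigenvalue_summable hγ.1
  obtain ⟨Q, hQ⟩ := exists_diagonal_clm_of_summable e hsum
  have hlim : Tendsto (fun j : ℕ => ((j : ℝ) + 1) ^ 2) atTop atTop :=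
    (tendsto_pow_atTop two_ne_zero).comp
      (tendsto_atTop_add_const_right _ _ tendsto_natCast_atTop_atTop)
  -- The constant `1 / 48` is universal; `T` and the law of `X₀` influence only the threshold `Δ₀`.
  refine ⟨diagOp e fun j => ((j : ℝ) + 1) ^ 2, Q, ⟨e, rfl, diagonal_apply_basis hQ⟩,
    diagonal_operatorAssumption hQ (fun j => by positivity) hlim (noiseEigenvalue_nonneg γ) hsum
      (noiseEigenvalue_weighted_summable γ), 1 / 48, by norm_num, ?_⟩
  intro Ω mΩ P hP ℱ W X X₀ ι hW hι h₀ hX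
  obtain ⟨Δ₀, hΔ₀, hlow⟩ :=
    exists_hsNorm_bias_lower_bound hγ hT (diagonal_apply_basis hQ) hW hι h₀ hX
  refine ⟨Δ₀, hΔ₀, fun Δ hΔ hΔlt => ?_⟩
  exact ⟨hX.integrable_realizedCovariation h₀.memLp T Δ, hX.hsNorm_bias_le e h₀.memLp T Δ,
    hlow Δ hΔ hΔlt⟩
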